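/- Let $0<\alpha<1$ and let $f(z)=z+\sum_{n=2}^\infty a_nz^n$ be a normalized convex univalent function in the unit disc $\mathbb D$ (holomorphic and injective in $\mathbb D$ with $f(\mathbb D)$ convex); put $a_1=1$. Let $$D^\alpha f(z)=\frac1{\Gamma(1-\alpha)}\frac{d}{dz}\int_0^z (z-t)^{-\alpha}f(t)\,dt$$ be its Riemann–Liouville fractional derivative, a multivalued function on $\mathbb D\setminus\{0\}$ whose branches differ by the constant unimodular factors $e^{-2\pi i k\alpha}$, $k\in\mathbb Z$ (so that $|D^\alpha f(z)|$ is single-valued). The limit $D^\alpha f(0):=\lim_{z\to0}D^\alpha f(z)$ exists; let $D^\alpha f(\mathbb D)$ be the set of the values of all branches together with $D^\alpha f(0)$. The limit $$L(\alpha)=\lim_{t\to1^-}\left|\frac{t^{1-\alpha}}{\Gamma(2-\alpha)}\;{}_2F_1(1,2;2-\alpha;-t)\right|$$ exists, and the equation $$\sum_{n=1}^\infty\frac{\Gamma(n+1)}{\Gamma(n+1-\alpha)}\,r^{n-\alpha}=L(\alpha)$$ has a smallest positive solution $r=P(\alpha)$, which is less than $1$. For all $0\le r\le P(\alpha)$ the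 series below converges and $$\sum_{n=1}^\infty\frac{\Gamma(n+1)}{\Gamma(n+1-\alpha)}\,|a_n|\,r^{n-\alpha}\le \mathrm{dist}\big(D^\alpha f(0),\partial D^\alpha f(\mathbb D)\big)$$ (the distance to the empty set being $+\infty$). Moreover the same sum is at most $\liminf_{|z|\to1^-}|D^\alpha f(z)-D^\alpha f(0)|$. -/

import Mathlib

open Filter Topology

/-- The class of normalized convex univalent functions on the open unit disc: `f` is holomorphic and
injective there, its image of the disc is convex, and `f 0 = 0`, `f' 0 = 1`. -/
structure IsNormalizedConvexUnivalent (f : ℂ → ℂ) : Prop where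
  holomorphic : DifferentiableOn ℂ f (Metric.ball 0 1)
  injective : Set.InjOn f (Metric.ball 0 1)
  convex_image : Convex ℝ (f '' Metric.ball 0 1)
  map_zero : f 0 = 0
  deriv_zero : deriv f 0 = 1

/-- `∫_0^z (z - t)^(-α) f(t) dt` along the segment `t = u z`, `0 ≤ u ≤ 1`, as a function of
`ζ = log z`.  As `z ↦ z ^ (-α)` is multivalued, the point `z ≠ 0` is given by a logarithm `ζ`,
`z = exp ζ`, and `(z - t)^(-α) = z^(-α) (1 - u)^(-α)` with `z^(-α) = exp (-α ζ)`. -/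
noncomputable def rlPrimitive (α : ℝ) (f : ℂ → ℂ) (ζ : ℂ) : ℂ :=
  ∫ u in (0 : ℝ)..1,
    (Complex.exp (-(α : ℂ) * ζ) * (((1 - u) ^ (-α) : ℝ) : ℂ)) * f ((u : ℂ) * Complex.exp ζ)
      * Complex.exp ζ

/-- The Riemann–Liouville fractional derivative
`D^α f (z) = (1 / Γ(1 - α)) (d/dz) ∫_0^z (z - t)^(-α) f(t) dt` at the point `z = exp ζ`, on the
branch given by `ζ`; here `d/dz = exp (-ζ) d/dζ`.  The values of the multivalued function
`D^α f` at `z` are the values at all logarithms `ζ` of `z`. -/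
noncomputable def fracDeriv (α : ℝ) (f : ℂ → ℂ) (ζ : ℂ) : ℂ :=
  ((Real.Gamma (1 - α) : ℝ) : ℂ)⁻¹ * (Complex.exp (-ζ) * deriv (rlPrimitive α f) ζ)

/-- The logarithms of the points of the punctured open unit disc. -/
def logDisc : Set ℂ := {ζ : ℂ | ζ.re < 0}

/-- `z → 0`, for `z = exp ζ`, over all branches. -/
def toCentre : Filter ℂ := comap Complex.re atBot

/-- `|z| → 1` from inside the disc, for `z = exp ζ`, in all directions and over all branches. -/
def toCircle : Filter ℂ := comap Complex.re (𝓝[<] 0)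

/-- The image `D^α f (𝔻)` of the whole disc (all branches), with the value `w₀` at the centre. -/
noncomputable def fracImage (α : ℝ) (f : ℂ → ℂ) (w₀ : ℂ) : Set ℂ :=
  insert w₀ (fracDeriv α f '' logDisc)

/-- The term `Γ(n+1) / Γ(n+1-α) * r^(n-α)`. -/
noncomputable def fracTerm (α r : ℝ) (n : ℕ) : ℝ :=
  Real.Gamma ((n : ℝ) + 1) / Real.Gamma ((n : ℝ) + 1 - α) * r ^ ((n : ℝ) - α)

/-- The majorant series `∑_{n ≥ 1} Γ(n+1) / Γ(n+1-α) |a_n| r^(n-α)`. -/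
noncomputable def fracMajorant (α : ℝ) (a : ℕ → ℂ) (r : ℝ) : ℝ :=
  ∑' n : ℕ, fracTerm α r (n + 1) * ‖a (n + 1)‖

/-!
Integration by parts writes `D^α f (z)` as `z ^ (1 - α)` times the Erdélyi–Kober integral of `f'`.
By Study's theorem `f` maps the disc of radius `|z|` onto a convex set, which has a supporting line
at `f z`; Harnack's inequality makes the support inequality quantitative along the segment
`[0, z]`, and integrating it against the weight `(1 - u) ^ (-α)`, which is nondecreasing, gives
`|D^α f (z)| ≥ |z| ^ (1 - α) L`, where `L` is the value at `-1` of the Euler integral of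
`Γ(2 - α)⁻¹ ₂F₁(1, 2; 2 - α; ·)`. Hence, away from `0` and below modulus `L`, values of `D^α f`
come from a compact annulus up to the rotations between the branches, so the image of the punctured
disc is relatively closed in the punctured disc of radius `L`. It is also open, so it contains that
punctured disc. On the other side, `|a n| ≤ 1` bounds the majorant series by its value for
`z / (1 - z)`, which increases from `0` to `L` on `[0, P]`.
-/

open Metric Set MeasureTheory

section InjectiveHolomorphic

variable {f : ℂ → ℂ} {U : Set ℂ}

theorem not_eventually_eq_const_of_injOn (hU : IsOpen U) (hinj : InjOn f U) {z : ℂ} (hz : z ∈ U)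
    (c : ℂ) : ¬ ∀ᶠ w in 𝓝 z, f w = c := by
  intro h
  obtain ⟨w, ⟨hwc, hwU⟩, hne⟩ := (((h.and (hU.mem_nhds hz)).filter_mono nhdsWithin_le_nhds).and
    (self_mem_nhdsWithin : {z}ᶜ ∈ 𝓝[≠] z)).exists
  exact hne (hinj hwU hz (hwc.trans h.self_of_nhds.symm))

theorem isOpen_image_of_injOn (hU : IsOpen U) (hd : DifferentiableOn ℂ f U) (hinj : InjOn f U) :
    IsOpen (f '' U) := by
  rw [isOpen_iff_mem_nhds]
  rintro _ ⟨z, hz, rfl⟩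
  exact (hd.analyticAt (hU.mem_nhds hz)).eventually_constant_or_nhds_le_map_nhds.resolve_left
    (not_eventually_eq_const_of_injOn hU hinj hz _) (image_mem_map (hU.mem_nhds hz))

theorem continuousOn_invFunOn_image (hU : IsOpen U) (hd : DifferentiableOn ℂ f U)
    (hinj : InjOn f U) : ContinuousOn (Function.invFunOn f U) (f '' U) := by
  refine (continuousOn_open_iff (isOpen_image_of_injOn hU hd hinj)).2 fun t ht => ?_
  rw [inter_comm, ← hinj.leftInvOn_invFunOn.image_inter']
  exact isOpen_image_of_injOn (ht.inter hU) (hd.mono inter_subset_right)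
    (hinj.mono inter_subset_right)

theorem eventually_deriv_ne_zero_of_injOn (hU : IsOpen U) (hd : DifferentiableOn ℂ f U)
    (hinj : InjOn f U) {z : ℂ} (hz : z ∈ U) : ∀ᶠ w in 𝓝[≠] z, deriv f w ≠ 0 := by
  refine ((hd.analyticAt (hU.mem_nhds hz)).deriv.eventually_eq_zero_or_eventually_ne_zero
    ).resolve_left fun h => ?_
  obtain ⟨ε, hε, hball⟩ := eventually_nhds_iff_ball.1 (h.and (hU.mem_nhds hz))
  refine not_eventually_eq_const_of_injOn hU hinj hz (f z) ?_
  filter_upwards [ball_mem_nhds z hε] with w hw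
  exact isOpen_ball.is_const_of_deriv_eq_zero (convex_ball z ε).isPreconnected
    (hd.mono fun w hw => (hball w hw).2) (fun w hw => (hball w hw).1) hw (mem_ball_self hε)

theorem differentiableOn_invFunOn_image (hU : IsOpen U) (hd : DifferentiableOn ℂ f U)
    (hinj : InjOn f U) : DifferentiableOn ℂ (Function.invFunOn f U) (f '' U) := by
  set F := Function.invFunOn f U
  have hopen := isOpen_image_of_injOn hU hd hinj
  have hright : LeftInvOn f F (f '' U) := fun w hw => Function.invFunOn_eq hw
  have hcont : ∀ w ∈ f '' U, ContinuousAt F w := fun w hw =>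
    (continuousOn_invFunOn_image hU hd hinj).continuousAt (hopen.mem_nhds hw)
  have hregular : ∀ w ∈ f '' U, deriv f (F w) ≠ 0 → DifferentiableAt ℂ F w := by
    intro w hw hne
    have hder : HasDerivAt f (deriv f (F w)) (F w) :=
      (hd.differentiableAt (hU.mem_nhds (Function.invFunOn_mem hw))).hasDerivAt
    exact (hder.of_local_left_inverse (hcont w hw) hne
      (eventually_of_mem (hopen.mem_nhds hw) hright)).differentiableAt
  intro w hw
  -- The critical points of `f` are isolated, and `F` is continuous: the singularity is removable.
  refine (Complex.analyticAt_of_differentiable_on_punctured_nhds_of_continuousAt ?_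
    (hcont w hw)).differentiableAt.differentiableWithinAt
  have hpunct : Tendsto F (𝓝[≠] w) (𝓝[≠] F w) := by
    refine tendsto_nhdsWithin_iff.2 ⟨(hcont w hw).tendsto.mono_left nhdsWithin_le_nhds, ?_⟩
    filter_upwards [self_mem_nhdsWithin, nhdsWithin_le_nhds (hopen.mem_nhds hw)] with v hne hv heq
    exact hne (hright.injOn hv hw heq)
  filter_upwards [hpunct.eventually
    (eventually_deriv_ne_zero_of_injOn hU hd hinj (Function.invFunOn_mem hw)),
    nhdsWithin_le_nhds (hopen.mem_nhds hw)] with v hne hv using hregular v hv hne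

end InjectiveHolomorphic

section PowerSeries

variable {f : ℂ → ℂ} {a : ℕ → ℂ} {ρ : ℝ}

theorem hasFPowerSeriesOnBall_of_hasSum (hρ : 0 < ρ)
    (ha : ∀ z ∈ ball (0 : ℂ) ρ, HasSum (fun n : ℕ => a n * z ^ n) (f z)) :
    HasFPowerSeriesOnBall f (FormalMultilinearSeries.ofScalars ℂ a) 0 (ENNReal.ofReal ρ) where
  r_le := by
    refine ENNReal.le_of_forall_nnreal_lt fun r hr => ?_
    refine FormalMultilinearSeries.le_radius_of_summable_norm _ ?_
    have hr' : (r : ℝ) < ρ := by simpa using (ENNReal.lt_ofReal_iff_toReal_lt (by simp)).1 hr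
    simpa using (ha (r : ℝ) (by simpa using hr')).summable.norm
  r_pos := by simpa using hρ
  hasSum {z} hz := by
    simpa [FormalMultilinearSeries.ofScalars_apply_eq, mul_comm] using
      ha z (by simpa [Metric.eball_ofReal] using hz)

theorem differentiableOn_ball_of_hasSum
    (ha : ∀ z ∈ ball (0 : ℂ) ρ, HasSum (fun n : ℕ => a n * z ^ n) (f z)) :
    DifferentiableOn ℂ f (ball 0 ρ) := by
  rcases le_or_gt ρ 0 with hρ | hρ
  · simp [ball_eq_empty.2 hρ, differentiableOn_empty]
  · simpa [Metric.eball_ofReal] using (hasFPowerSeriesOnBall_of_hasSum hρ ha).differentiableOn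

theorem deriv_zero_of_hasSum (hρ : 0 < ρ)
    (ha : ∀ z ∈ ball (0 : ℂ) ρ, HasSum (fun n : ℕ => a n * z ^ n) (f z)) :
    deriv f 0 = a 1 := by
  simpa using (hasFPowerSeriesOnBall_of_hasSum hρ ha).hasFPowerSeriesAt.deriv

theorem sum_range_pow_pow_eq_ite {n : ℕ} {ω : ℂ} (hω : IsPrimitiveRoot ω n) (m : ℕ) :
    ∑ j ∈ Finset.range n, (ω ^ j) ^ m = if n ∣ m then (n : ℂ) else 0 := by
  rw [Finset.sum_congr rfl fun j _ => pow_right_comm ω j m]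
  split_ifs with hm
  · simp [(hω.pow_eq_one_iff_dvd m).2 hm]
  · rw [geom_sum_eq (mt (hω.pow_eq_one_iff_dvd m).1 hm), ← pow_mul, mul_comm, pow_mul,
      hω.pow_eq_one, one_pow, sub_self, zero_div]

theorem hasSum_average_rootsOfUnity {n : ℕ} (hn : n ≠ 0) {ω : ℂ} (hω : IsPrimitiveRoot ω n)
    {w : ℂ} {s : ℕ → ℂ} (hs : ∀ j, HasSum (fun m : ℕ => a m * (ω ^ j * w) ^ m) (s j)) :
    HasSum (fun k : ℕ => a (n * k) * (w ^ n) ^ k) ((n : ℂ)⁻¹ * ∑ j ∈ Finset.range n, s j) := by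
  have hterm (m : ℕ) : (n : ℂ)⁻¹ * ∑ j ∈ Finset.range n, a m * (ω ^ j * w) ^ m =
      if n ∣ m then a m * w ^ m else 0 := by
    have hn' : (n : ℂ) ≠ 0 := Nat.cast_ne_zero.2 hn
    simp only [mul_pow]
    rw [← Finset.mul_sum, ← Finset.sum_mul, sum_range_pow_pow_eq_ite hω]
    split_ifs
    · field_simp
    · simp
  have hsum := (hasSum_sum fun j (_ : j ∈ Finset.range n) => hs j).mul_left (n : ℂ)⁻¹
  simp only [hterm] at hsum
  rw [← (mul_right_injective₀ hn).hasSum_iff fun m hm =>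
    if_neg fun ⟨k, hk⟩ => hm ⟨k, hk.symm⟩] at hsum
  simpa [Function.comp_def, pow_mul] using hsum

end PowerSeries

section PositiveRealPart

variable {h : ℂ → ℂ} {ρ : ℝ}

open ComplexConjugate

theorem norm_sub_le_norm_add_conj {w c : ℂ} (hw : 0 ≤ w.re) (hc : 0 ≤ c.re) :
    ‖w - c‖ ≤ ‖w + conj c‖ := by
  rw [← sq_le_sq₀ (norm_nonneg _) (norm_nonneg _), Complex.sq_norm, Complex.sq_norm,
    Complex.normSq_apply, Complex.normSq_apply]
  simp only [Complex.sub_re, Complex.sub_im, Complex.add_re, Complex.add_im, Complex.conj_re,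
    Complex.conj_im]
  nlinarith

theorem add_conj_ne_zero {w c : ℂ} (hw : 0 < w.re) (hc : 0 < c.re) : w + conj c ≠ 0 := by
  intro h
  have := congrArg Complex.re h
  simp only [Complex.add_re, Complex.conj_re, Complex.zero_re] at this
  linarith

/-- The Cayley transform of a function with positive real part, taking the value `0` at the
origin; the Schwarz lemma for it yields Harnack's inequality. -/
noncomputable def cayleyAtZero (h : ℂ → ℂ) (z : ℂ) : ℂ :=
  (h z - h 0) / (h z + conj (h 0))

theorem mapsTo_cayleyAtZero (hpos : ∀ z ∈ ball (0 : ℂ) ρ, 0 < (h z).re) :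
    MapsTo (cayleyAtZero h) (ball 0 ρ) (closedBall (cayleyAtZero h 0) 1) := by
  intro z hz
  have h0 := hpos 0 (mem_ball_self (pos_of_mem_ball hz))
  simpa [cayleyAtZero] using div_le_one_of_le₀
    (norm_sub_le_norm_add_conj (hpos z hz).le h0.le) (norm_nonneg _)

theorem differentiableOn_cayleyAtZero (hd : DifferentiableOn ℂ h (ball 0 ρ))
    (hpos : ∀ z ∈ ball (0 : ℂ) ρ, 0 < (h z).re) :
    DifferentiableOn ℂ (cayleyAtZero h) (ball 0 ρ) :=
  (hd.sub_const _).div (hd.add_const _) fun z hz =>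
    add_conj_ne_zero (hpos z hz) (hpos 0 (mem_ball_self (pos_of_mem_ball hz)))

theorem norm_deriv_mul_le_of_re_pos (hρ : 0 < ρ) (hd : DifferentiableOn ℂ h (ball 0 ρ))
    (hpos : ∀ z ∈ ball (0 : ℂ) ρ, 0 < (h z).re) : ‖deriv h 0‖ * ρ ≤ 2 * (h 0).re := by
  have h0 := mem_ball_self (x := (0 : ℂ)) hρ
  have hre := hpos 0 h0
  have hsum : h 0 + conj (h 0) = (2 * (h 0).re : ℝ) := Complex.add_conj _
  have hder : HasDerivAt (cayleyAtZero h) (deriv h 0 / (h 0 + conj (h 0))) 0 := by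
    have hh := (hd.differentiableAt (isOpen_ball.mem_nhds h0)).hasDerivAt
    have hne := add_conj_ne_zero hre hre
    refine ((hh.sub_const (h 0)).fun_div (hh.add_const (conj (h 0))) hne).congr_deriv ?_
    field_simp
    ring
  have hschwarz := Complex.norm_deriv_le_div_of_mapsTo_ball
    (differentiableOn_cayleyAtZero hd hpos) (mapsTo_cayleyAtZero hpos) hρ
  rwa [hder.deriv, hsum, norm_div, Complex.norm_of_nonneg (by positivity),
    div_le_div_iff₀ (by positivity) hρ, one_mul] at hschwarz

theorem norm_sub_mul_le_of_re_pos (hd : DifferentiableOn ℂ h (ball 0 ρ))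
    (hpos : ∀ z ∈ ball (0 : ℂ) ρ, 0 < (h z).re) {z : ℂ} (hz : z ∈ ball (0 : ℂ) ρ) :
    ‖h z - h 0‖ * ρ ≤ ‖z‖ * ‖h z + conj (h 0)‖ := by
  have hρ := pos_of_mem_ball hz
  have hne := norm_pos_iff.2 (add_conj_ne_zero (hpos z hz) (hpos 0 (mem_ball_self hρ)))
  have hschwarz := Complex.dist_le_div_mul_dist_of_mapsTo_ball
    (differentiableOn_cayleyAtZero hd hpos) (mapsTo_cayleyAtZero hpos) hz
  simp only [cayleyAtZero, sub_self, zero_div, dist_zero_right, norm_div] at hschwarz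
  rwa [div_le_iff₀ hne, div_mul_eq_mul_div, one_mul, div_mul_eq_mul_div, le_div_iff₀ hρ]
    at hschwarz

theorem harnack_of_re_pos (hd : DifferentiableOn ℂ h (ball 0 ρ))
    (hpos : ∀ z ∈ ball (0 : ℂ) ρ, 0 < (h z).re) {z : ℂ} (hz : z ∈ ball (0 : ℂ) ρ) :
    (h 0).re * (ρ - ‖z‖) ≤ (h z).re * (ρ + ‖z‖) := by
  have hzρ : ‖z‖ < ρ := by simpa using hz
  have hρ := pos_of_mem_ball hz
  have hre := hpos z hz
  have hre0 := hpos 0 (mem_ball_self hρ)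
  have hcayley : (‖h z - h 0‖ * ρ) ^ 2 ≤ (‖z‖ * ‖h z + conj (h 0)‖) ^ 2 :=
    pow_le_pow_left₀ (by positivity) (norm_sub_mul_le_of_re_pos hd hpos hz) 2
  rw [mul_pow, mul_pow, Complex.sq_norm, Complex.sq_norm (_ + _), Complex.normSq_apply,
    Complex.normSq_apply] at hcayley
  simp only [Complex.sub_re, Complex.sub_im, Complex.add_re, Complex.add_im, Complex.conj_re,
    Complex.conj_im] at hcayley
  have hreal : (((h 0).re - (h z).re) * ρ) ^ 2 ≤ (‖z‖ * ((h z).re + (h 0).re)) ^ 2 := by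
    have : ‖z‖ ^ 2 ≤ ρ ^ 2 := by gcongr
    nlinarith [sq_nonneg ((h z).im - (h 0).im)]
  linarith [le_of_sq_le_sq hreal (by positivity)]

end PositiveRealPart

/-- Convex univalent functions on the unit disc, without the normalization `f 0 = 0`, `f' 0 = 1`. -/
structure IsConvexUnivalent (f : ℂ → ℂ) : Prop where
  differentiableOn : DifferentiableOn ℂ f (ball 0 1)
  injOn : InjOn f (ball 0 1)
  convex_image : Convex ℝ (f '' ball 0 1)

theorem IsNormalizedConvexUnivalent.isConvexUnivalent {f : ℂ → ℂ}
    (hf : IsNormalizedConvexUnivalent f) : IsConvexUnivalent f :=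
  ⟨hf.holomorphic, hf.injective, hf.convex_image⟩

namespace IsConvexUnivalent

variable {f g : ℂ → ℂ} {a : ℕ → ℂ}

theorem isOpen_image_ball (hf : IsConvexUnivalent f) {ρ : ℝ} (hρ : ρ ≤ 1) :
    IsOpen (f '' ball 0 ρ) :=
  isOpen_image_of_injOn isOpen_ball (hf.differentiableOn.mono (ball_subset_ball hρ))
    (hf.injOn.mono (ball_subset_ball hρ))

theorem exists_subordination (hf : IsConvexUnivalent f) (hg : DifferentiableOn ℂ g (ball 0 1))
    (hmaps : MapsTo g (ball 0 1) (f '' ball 0 1)) (h0 : g 0 = f 0) :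
    ∃ φ : ℂ → ℂ, DifferentiableOn ℂ φ (ball 0 1) ∧ MapsTo φ (ball 0 1) (ball 0 1) ∧ φ 0 = 0 ∧
      EqOn (f ∘ φ) g (ball 0 1) := by
  refine ⟨Function.invFunOn f (ball 0 1) ∘ g, ?_, ?_, ?_, ?_⟩
  · exact (differentiableOn_invFunOn_image isOpen_ball hf.differentiableOn hf.injOn).comp hg hmaps
  · exact fun z hz => Function.invFunOn_mem (hmaps hz)
  · simpa [h0] using hf.injOn.leftInvOn_invFunOn (mem_ball_self one_pos)
  · exact fun z hz => Function.invFunOn_eq (hmaps hz)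

theorem mem_image_closedBall_of_subordinate (hf : IsConvexUnivalent f)
    (hg : DifferentiableOn ℂ g (ball 0 1)) (hmaps : MapsTo g (ball 0 1) (f '' ball 0 1))
    (h0 : g 0 = f 0) {z : ℂ} (hz : z ∈ ball (0 : ℂ) 1) : g z ∈ f '' closedBall 0 ‖z‖ := by
  obtain ⟨φ, hφ, hφmaps, hφ0, hφg⟩ := hf.exists_subordination hg hmaps h0
  refine ⟨φ z, ?_, hφg hz⟩
  simpa using Complex.norm_le_norm_of_mapsTo_ball hφ (hφmaps.mono_right ball_subset_closedBall)
    hφ0 (by simpa using hz)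

theorem norm_deriv_le_of_subordinate (hf : IsConvexUnivalent f)
    (hg : DifferentiableOn ℂ g (ball 0 1)) (hmaps : MapsTo g (ball 0 1) (f '' ball 0 1))
    (h0 : g 0 = f 0) : ‖deriv g 0‖ ≤ ‖deriv f 0‖ := by
  obtain ⟨φ, hφ, hφmaps, hφ0, hφg⟩ := hf.exists_subordination hg hmaps h0
  have hnhds : ball (0 : ℂ) 1 ∈ 𝓝 0 := ball_mem_nhds 0 one_pos
  have hchain : HasDerivAt (f ∘ φ) (deriv f 0 * deriv φ 0) 0 := by
    refine HasDerivAt.comp 0 ?_ (hφ.differentiableAt hnhds).hasDerivAt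
    exact hφ0.symm ▸ (hf.differentiableOn.differentiableAt hnhds).hasDerivAt
  have hschwarz : ‖deriv φ 0‖ ≤ 1 := Complex.norm_deriv_le_one_of_mapsTo_ball hφ
    ((hφmaps.mono_right ball_subset_closedBall).mono_right (by rw [hφ0])) one_pos
  rw [(hchain.congr_of_eventuallyEq (hφg.eventuallyEq_of_mem hnhds).symm).deriv, norm_mul]
  exact mul_le_of_le_one_right (norm_nonneg _) hschwarz

/-- Study's theorem. -/
theorem convex_image_ball (hf : IsConvexUnivalent f) {ρ : ℝ} (hρ : ρ ≤ 1) :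
    Convex ℝ (f '' ball 0 ρ) := by
  have hordered : ∀ z₁ z₂ : ℂ, ‖z₁‖ ≤ ‖z₂‖ → ‖z₂‖ < ρ → ∀ s t : ℝ, 0 ≤ s → 0 ≤ t → s + t = 1 →
      s • f z₁ + t • f z₂ ∈ f '' ball 0 ρ := by
    intro z₁ z₂ h12 h2 s t hs ht hst
    have hq : ‖z₁ / z₂‖ ≤ 1 := by
      rw [norm_div]
      exact div_le_one_of_le₀ h12 (norm_nonneg _)
    have hscale : MapsTo (fun z : ℂ => z₁ / z₂ * z) (ball 0 1) (ball 0 1) := by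
      intro z hz
      rw [mem_ball_zero_iff, norm_mul] at *
      exact (mul_le_of_le_one_left (norm_nonneg z) hq).trans_lt hz
    -- `z ↦ s f(z₁ z / z₂) + t f(z)` is subordinate to `f`.
    have hmem : s • f (z₁ / z₂ * z₂) + t • f z₂ ∈ f '' closedBall 0 ‖z₂‖ := by
      refine hf.mem_image_closedBall_of_subordinate
        (g := fun z => s • f (z₁ / z₂ * z) + t • f z) ?_ ?_ ?_ ?_
      · exact ((hf.differentiableOn.comp (by fun_prop) hscale).const_smul s).add
          (hf.differentiableOn.const_smul t)
      · exact fun z hz => hf.convex_image ⟨_, hscale hz, rfl⟩ ⟨z, hz, rfl⟩ hs ht hst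
      · rw [mul_zero, ← add_smul, hst, one_smul]
      · simpa using h2.trans_le hρ
    have hcancel : z₁ / z₂ * z₂ = z₁ :=
      div_mul_cancel_of_imp fun h => by simpa [h] using h12
    rw [hcancel] at hmem
    exact image_mono (closedBall_subset_ball h2) hmem
  rintro _ ⟨z₁, h1, rfl⟩ _ ⟨z₂, h2, rfl⟩ s t hs ht hst
  rw [mem_ball_zero_iff] at h1 h2
  rcases le_total ‖z₁‖ ‖z₂‖ with h | h
  · exact hordered z₁ z₂ h h2 s t hs ht hst
  · rw [add_comm]
    exact hordered z₂ z₁ h h1 t s ht hs (by rwa [add_comm])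

/-- Löwner's coefficient bound: averaging `f` over the rotations by `n`-th roots of unity gives a
function of `z ^ n` which is subordinate to `f` and has linear coefficient `a n`. -/
theorem norm_coeff_le (hf : IsConvexUnivalent f)
    (ha : ∀ z ∈ ball (0 : ℂ) 1, HasSum (fun n : ℕ => a n * z ^ n) (f z)) {n : ℕ} (hn : n ≠ 0) :
    ‖a n‖ ≤ ‖deriv f 0‖ := by
  obtain ⟨ω, hω⟩ : ∃ ω : ℂ, IsPrimitiveRoot ω n := ⟨_, Complex.isPrimitiveRoot_exp n hn⟩
  have haverage : ∀ z ∈ ball (0 : ℂ) 1,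
      ∃ w ∈ f '' ball 0 1, HasSum (fun k : ℕ => a (n * k) * z ^ k) w := by
    intro z hz
    obtain ⟨w, rfl⟩ := IsAlgClosed.exists_pow_nat_eq z (Nat.pos_of_ne_zero hn)
    have hw : ‖w‖ < 1 := by
      rwa [mem_ball_zero_iff, norm_pow, pow_lt_one_iff_of_nonneg (norm_nonneg w) hn] at hz
    have hrot (j : ℕ) : ω ^ j * w ∈ ball (0 : ℂ) 1 := by
      simpa [hω.norm'_eq_one hn] using hw
    refine ⟨_, ?_, hasSum_average_rootsOfUnity hn hω fun j => ha _ (hrot j)⟩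
    have hmem : ∑ j ∈ Finset.range n, (n : ℝ)⁻¹ • f (ω ^ j * w) ∈ f '' ball 0 1 :=
      hf.convex_image.sum_mem (fun _ _ => by positivity) (by simp [hn])
        fun j _ => mem_image_of_mem f (hrot j)
    simpa [Finset.mul_sum] using hmem
  choose! g hgmem hgsum using haverage
  have h0 : g 0 = f 0 := by
    have hconst (b : ℕ → ℂ) : HasSum (fun k : ℕ => b k * 0 ^ k) (b 0) := by
      simpa using hasSum_single (f := fun k : ℕ => b k * 0 ^ k) 0 fun k hk => by simp [hk]
    have hzero := mem_ball_self (x := (0 : ℂ)) one_pos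
    exact ((hgsum 0 hzero).unique (hconst _)).trans ((hconst a).unique (ha 0 hzero))
  simpa [deriv_zero_of_hasSum one_pos hgsum] using
    hf.norm_deriv_le_of_subordinate (differentiableOn_ball_of_hasSum hgsum) hgmem h0

theorem exists_support (hf : IsConvexUnivalent f) {z : ℂ} (hz : ‖z‖ < 1) :
    ∃ ν : ℂ, ∀ w ∈ ball (0 : ℂ) ‖z‖, 0 < ((f z - f w) * ν).re := by
  have hnot : f z ∉ f '' ball 0 ‖z‖ := by
    rintro ⟨w, hw, hfw⟩
    rw [hf.injOn (ball_subset_ball hz.le hw) (by simpa using hz) hfw] at hw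
    simp at hw
  obtain ⟨φ, hφ⟩ := RCLike.geometric_hahn_banach_open_point (𝕜 := ℂ)
    (hf.convex_image_ball hz.le) (hf.isOpen_image_ball hz.le) hnot
  have hmul (w : ℂ) : φ w = w * φ 1 := by
    simpa using φ.map_smul w 1
  refine ⟨φ 1, fun w hw => ?_⟩
  rw [← hmul, map_sub, Complex.sub_re]
  exact sub_pos.2 (hφ _ (mem_image_of_mem f hw))

/-- The support inequality, quantified by Harnack's inequality; the constant is attained for
`f z = z / (1 - z)` in the limit `z → -1`. -/
theorem exists_support_radial (hf : IsConvexUnivalent f) {z : ℂ} (hz0 : z ≠ 0) (hz : ‖z‖ < 1) :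
    ∃ ν : ℂ, ν ≠ 0 ∧ ∀ u ∈ Ico (0 : ℝ) 1,
      ‖deriv f 0 * z * ν‖ / 2 * ((1 - u) / (1 + u)) ≤ ((f z - f (u • z)) * ν).re := by
  obtain ⟨ν, hν⟩ := hf.exists_support hz
  have hρ : 0 < ‖z‖ := norm_pos_iff.2 hz0
  have hd : DifferentiableOn ℂ (fun w => (f z - f w) * ν) (ball 0 ‖z‖) :=
    ((hf.differentiableOn.mono (ball_subset_ball hz.le)).const_sub _).mul_const _
  have hder : ‖deriv (fun w => (f z - f w) * ν) 0‖ = ‖deriv f 0‖ * ‖ν‖ := by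
    have hf0 := hf.differentiableOn.differentiableAt (ball_mem_nhds (0 : ℂ) one_pos)
    rw [((hf0.hasDerivAt.const_sub (f z)).mul_const ν).deriv, norm_mul, norm_neg]
  have hcentre := norm_deriv_mul_le_of_re_pos hρ hd hν
  rw [hder] at hcentre
  refine ⟨ν, ?_, fun u hu => ?_⟩
  · rintro rfl
    simpa using hν 0 (mem_ball_self hρ)
  have hnorm : ‖u • z‖ = u * ‖z‖ := by rw [norm_smul, Real.norm_of_nonneg hu.1]
  have hmem : u • z ∈ ball (0 : ℂ) ‖z‖ := by
    rw [mem_ball_zero_iff, hnorm]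
    exact mul_lt_of_lt_one_left hρ hu.2
  have hharnack := harnack_of_re_pos hd hν hmem
  have hu0 := hu.1
  rw [hnorm, show ‖z‖ - u * ‖z‖ = (1 - u) * ‖z‖ by ring,
    show ‖z‖ + u * ‖z‖ = (1 + u) * ‖z‖ by ring, ← mul_assoc, ← mul_assoc,
    mul_le_mul_iff_left₀ hρ, ← div_le_iff₀ (by positivity), mul_div_assoc] at hharnack
  refine le_trans ?_ hharnack
  have hu1 := sub_nonneg.2 hu.2.le
  gcongr
  rw [norm_mul, norm_mul]
  linarith

end IsConvexUnivalent

section OneSubRpow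

variable {α : ℝ}

theorem intervalIntegrable_one_sub_rpow (hα1 : α < 1) :
    IntervalIntegrable (fun u : ℝ => (1 - u) ^ (-α)) volume 0 1 := by
  simpa using ((intervalIntegral.intervalIntegrable_rpow' (a := 0) (b := 1)
    (show -1 < -α by linarith)).comp_sub_left 1).symm

theorem intervalIntegrable_one_sub_rpow_smul {F : Type*} [NormedAddCommGroup F] [NormedSpace ℝ F]
    (hα1 : α < 1) {φ : ℝ → F} (hφ : ContinuousOn φ (Icc 0 1)) :
    IntervalIntegrable (fun u : ℝ => (1 - u) ^ (-α) • φ u) volume 0 1 :=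
  (intervalIntegrable_one_sub_rpow hα1).smul_continuousOn (by rwa [uIcc_of_le zero_le_one])

theorem hasDerivAt_one_sub_rpow {p u : ℝ} (hu : u < 1) :
    HasDerivAt (fun u : ℝ => (1 - u) ^ p) (-(p * (1 - u) ^ (p - 1))) u := by
  simpa using ((hasDerivAt_id u).const_sub 1).rpow_const (p := p) (Or.inl (by simp; linarith))

theorem continuousOn_one_sub_rpow_mul (hα1 : α < 1) {χ : ℝ → ℝ}
    (hχ : ∀ u ∈ Icc (0 : ℝ) 1, DifferentiableAt ℝ χ u) (hχ1 : χ 1 = 0) :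
    ContinuousOn (fun u : ℝ => (1 - u) ^ (-α) * χ u) (Icc 0 1) := by
  have hslope : ContinuousOn (dslope χ 1) (Icc 0 1) := by
    intro u hu
    rcases eq_or_ne u 1 with rfl | h
    · exact (continuousAt_dslope_same.2 (hχ 1 hu)).continuousWithinAt
    · exact ((continuousAt_dslope_of_ne h).2 (hχ u hu).continuousAt).continuousWithinAt
  have hprod : ContinuousOn (fun u : ℝ => -((1 - u) ^ (1 - α) * dslope χ 1 u)) (Icc 0 1) :=
    ((ContinuousOn.rpow_const (by fun_prop) fun u _ => Or.inr (by linarith)).mul hslope).neg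
  refine hprod.congr fun u hu => ?_
  have hslope_mul : (u - 1) * dslope χ 1 u = χ u := by
    simpa [hχ1] using sub_smul_dslope χ 1 u
  rcases hu.2.eq_or_lt with rfl | h
  · simp [hχ1, Real.zero_rpow (show 1 - α ≠ 0 by linarith)]
  · beta_reduce
    rw [sub_eq_neg_add 1 α, Real.rpow_add_one (by linarith), ← hslope_mul]
    ring

theorem integral_one_sub_rpow_mul_deriv_nonneg (hα0 : 0 ≤ α) (hα1 : α < 1)
    {χ χ' : ℝ → ℝ} (hχ : ∀ u ∈ Icc (0 : ℝ) 1, HasDerivAt χ (χ' u) u)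
    (hχ' : ContinuousOn χ' (Icc 0 1)) (hχ1 : χ 1 = 0) (hχ0 : ∀ u ∈ Icc (0 : ℝ) 1, χ u ≤ 0) :
    0 ≤ ∫ u in (0 : ℝ)..1, (1 - u) ^ (-α) * χ' u := by
  have hboundary := intervalIntegral.sub_le_integral_of_hasDeriv_right_of_le zero_le_one
    (continuousOn_one_sub_rpow_mul hα1 (fun u hu => (hχ u hu).differentiableAt) hχ1)
    (g' := fun u => α * (1 - u) ^ (-α - 1) * χ u + (1 - u) ^ (-α) * χ' u)
    (φ := fun u => (1 - u) ^ (-α) * χ' u) ?_ ?_ ?_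
  · have := hχ0 0 (by simp)
    simp only [hχ1, mul_zero, sub_zero, Real.one_rpow, one_mul] at hboundary
    linarith
  · intro u hu
    refine (((hasDerivAt_one_sub_rpow hu.2).mul (hχ u ⟨hu.1.le, hu.2.le⟩)).congr_deriv
      ?_).hasDerivWithinAt
    ring
  · exact (intervalIntegrable_iff_integrableOn_Icc_of_le zero_le_one).1
      (intervalIntegrable_one_sub_rpow_smul hα1 hχ')
  · intro u hu
    have hweight : 0 ≤ α * (1 - u) ^ (-α - 1) :=
      mul_nonneg hα0 (Real.rpow_nonneg (sub_nonneg.2 hu.2.le) _)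
    have := mul_nonpos_of_nonneg_of_nonpos hweight (hχ0 u ⟨hu.1.le, hu.2.le⟩)
    linarith

theorem integral_one_sub_rpow_mul_deriv_mono (hα0 : 0 ≤ α) (hα1 : α < 1) {φ φ' ψ ψ' : ℝ → ℝ}
    (hφ : ∀ u ∈ Icc (0 : ℝ) 1, HasDerivAt φ (φ' u) u) (hφ' : ContinuousOn φ' (Icc 0 1))
    (hψ : ∀ u ∈ Icc (0 : ℝ) 1, HasDerivAt ψ (ψ' u) u) (hψ' : ContinuousOn ψ' (Icc 0 1))
    (h1 : ψ 1 = φ 1) (hle : ∀ u ∈ Ico (0 : ℝ) 1, ψ u ≤ φ u) :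
    ∫ u in (0 : ℝ)..1, (1 - u) ^ (-α) * φ' u ≤ ∫ u in (0 : ℝ)..1, (1 - u) ^ (-α) * ψ' u := by
  have hnonneg := integral_one_sub_rpow_mul_deriv_nonneg hα0 hα1 (χ := fun u => ψ u - φ u)
    (fun u hu => (hψ u hu).sub (hφ u hu)) (hψ'.sub hφ') (sub_eq_zero.2 h1) fun u hu => by
      rcases hu.2.eq_or_lt with rfl | h
      · exact (sub_eq_zero.2 h1).le
      · exact sub_nonpos.2 (hle u ⟨hu.1, h⟩)
  have hintegrable {χ : ℝ → ℝ} (hχ : ContinuousOn χ (Icc 0 1)) :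
      IntervalIntegrable (fun u => (1 - u) ^ (-α) * χ u) volume 0 1 :=
    intervalIntegrable_one_sub_rpow_smul hα1 hχ
  simp only [mul_sub] at hnonneg
  rwa [intervalIntegral.integral_sub (hintegrable hψ') (hintegrable hφ'), sub_nonneg] at hnonneg

theorem integral_one_sub_rpow_mul_pow (hα1 : α < 1) (n : ℕ) :
    ∫ u in (0 : ℝ)..1, (1 - u) ^ (-α) * u ^ n =
      Real.Gamma (n + 1) * Real.Gamma (1 - α) / Real.Gamma (n + 2 - α) := by
  have hbeta := Complex.betaIntegral_eq_Gamma_mul_div ((n + 1 : ℝ) : ℂ) ((1 - α : ℝ) : ℂ)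
    (by rw [Complex.ofReal_re]; positivity) (by rw [Complex.ofReal_re]; linarith)
  rw [Complex.betaIntegral, ← Complex.ofReal_add, Complex.Gamma_ofReal, Complex.Gamma_ofReal,
    Complex.Gamma_ofReal] at hbeta
  rw [← Complex.ofReal_inj, ← intervalIntegral.integral_ofReal]
  push_cast at hbeta ⊢
  rw [show (n : ℝ) + 2 - α = n + 1 + (1 - α) by ring, ← hbeta]
  refine intervalIntegral.integral_congr fun u hu => ?_
  rw [uIcc_of_le zero_le_one] at hu
  simp only [add_sub_cancel_right, Complex.cpow_natCast, Complex.ofReal_cpow (sub_nonneg.2 hu.2)]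
  push_cast
  rw [sub_sub_cancel_left, mul_comm]

end OneSubRpow

section ErdelyiKober

/-- The Erdélyi–Kober fractional integral `Γ(1 - α)⁻¹ ∫₀¹ (1 - u) ^ (-α) g(u z) du`: the
Riemann–Liouville integral of order `1 - α` of `g` from `0` to `z` along the segment, divided by
its multivalued factor `z ^ (1 - α)`. -/
noncomputable def erdelyiKober {E F : Type*} [SMul ℝ E] [NormedAddCommGroup F] [NormedSpace ℝ F]
    (α : ℝ) (g : E → F) (z : E) : F :=
  (Real.Gamma (1 - α))⁻¹ • ∫ u in (0 : ℝ)..1, (1 - u) ^ (-α) • g (u • z)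

theorem continuousOn_comp_smul {E F : Type*} [AddCommGroup E] [Module ℝ E] [TopologicalSpace E]
    [ContinuousSMul ℝ E] [TopologicalSpace F] {g : E → F} {s : Set E} {z : E}
    (hs : StarConvex ℝ 0 s) (hg : ContinuousOn g s) (hz : z ∈ s) :
    ContinuousOn (fun u : ℝ => g (u • z)) (Icc 0 1) :=
  hg.comp (by fun_prop) fun _ hu => hs.smul_mem hz hu.1 hu.2

theorem eventually_forall_norm_comp_smul_le {E F : Type*} [AddCommGroup E] [Module ℝ E]
    [TopologicalSpace E] [ContinuousSMul ℝ E] [SeminormedAddCommGroup F] {g : E → F} {s : Set E}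
    {z : E} (hso : IsOpen s) (hs : StarConvex ℝ 0 s) (hg : ContinuousOn g s)
    (hz : z ∈ s) :
    ∃ C : ℝ, ∀ᶠ w in 𝓝 z, ∀ u ∈ Icc (0 : ℝ) 1, ‖g (u • w)‖ ≤ C := by
  obtain ⟨C, hC⟩ := isCompact_Icc.exists_bound_of_continuousOn (continuousOn_comp_smul hs hg hz)
  refine ⟨C + 1, isCompact_Icc.eventually_forall_of_forall_eventually fun u hu => ?_⟩
  have hcont : ContinuousAt (fun p : E × ℝ => ‖g (p.2 • p.1)‖) (z, u) := by
    have hgu := hg.continuousAt (hso.mem_nhds (hs.smul_mem hz hu.1 hu.2))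
    exact (ContinuousAt.comp (f := fun p : E × ℝ => p.2 • p.1) hgu (by fun_prop)).norm
  exact (hcont.eventually_lt continuousAt_const ((hC u hu).trans_lt (lt_add_one C))).mono
    fun _ h => h.le

variable {α : ℝ} {E F : Type*} [NormedAddCommGroup E] [NormedSpace ℝ E]
  [NormedAddCommGroup F] [NormedSpace ℝ F] {g : E → F} {s : Set E} {z : E}

theorem Gamma_one_sub_pos (hα1 : α < 1) : 0 < Real.Gamma (1 - α) :=
  Real.Gamma_pos_of_pos (sub_pos.2 hα1)

theorem continuousAt_erdelyiKober (hα1 : α < 1) (hso : IsOpen s) (hs : StarConvex ℝ 0 s)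
    (hg : ContinuousOn g s) (hz : z ∈ s) : ContinuousAt (erdelyiKober α g) z := by
  obtain ⟨C, hC⟩ := eventually_forall_norm_comp_smul_le hso hs hg hz
  refine ContinuousAt.const_smul (intervalIntegral.continuousAt_of_dominated_interval
    (bound := fun u => (1 - u) ^ (-α) * C) ?_ ?_
    (intervalIntegrable_one_sub_rpow_smul hα1 continuousOn_const) ?_) _
  · filter_upwards [hso.mem_nhds hz] with w hw
    exact (intervalIntegrable_iff.1 (intervalIntegrable_one_sub_rpow_smul hα1
      (continuousOn_comp_smul hs hg hw))).aestronglyMeasurable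
  · filter_upwards [hC] with w hw
    refine Eventually.of_forall fun u hu => ?_
    rw [uIoc_of_le zero_le_one] at hu
    rw [norm_smul, Real.norm_of_nonneg (Real.rpow_nonneg (sub_nonneg.2 hu.2) _)]
    exact mul_le_mul_of_nonneg_left (hw u (Ioc_subset_Icc_self hu))
      (Real.rpow_nonneg (sub_nonneg.2 hu.2) _)
  · refine Eventually.of_forall fun u hu => ?_
    rw [uIoc_of_le zero_le_one] at hu
    have hgu := hg.continuousAt (hso.mem_nhds (hs.smul_mem hz hu.1.le hu.2))
    exact (ContinuousAt.comp (f := fun w : E => u • w) hgu (by fun_prop)).const_smul _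

theorem hasSum_erdelyiKober [CompleteSpace F] (hα1 : α < 1) {c : ℕ → F}
    (hc : Summable fun n => ‖c n‖)
    (hg : ∀ u ∈ Icc (0 : ℝ) 1, HasSum (fun n : ℕ => u ^ n • c n) (g (u • z))) :
    HasSum (fun n : ℕ => (Real.Gamma (n + 1) / Real.Gamma (n + 2 - α)) • c n)
      (erdelyiKober α g z) := by
  have hΓ := (Gamma_one_sub_pos hα1).ne'
  have hterm (n : ℕ) : (Real.Gamma (1 - α))⁻¹ • ∫ u in (0 : ℝ)..1, (1 - u) ^ (-α) • u ^ n • c n =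
      (Real.Gamma (n + 1) / Real.Gamma (n + 2 - α)) • c n := by
    simp only [← mul_smul]
    rw [intervalIntegral.integral_smul_const, integral_one_sub_rpow_mul_pow hα1, ← mul_smul]
    congr 1
    field_simp
  simp only [← hterm]
  refine (intervalIntegral.hasSum_integral_of_dominated_convergence
    (fun n u => (1 - u) ^ (-α) * ‖c n‖) ?_ ?_ ?_ ?_ ?_).const_smul _
  · exact fun n => (intervalIntegrable_iff.1 (intervalIntegrable_one_sub_rpow_smul hα1
      (by fun_prop))).aestronglyMeasurable
  · refine fun n => Eventually.of_forall fun u hu => ?_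
    rw [uIoc_of_le zero_le_one] at hu
    have hw := Real.rpow_nonneg (sub_nonneg.2 hu.2) (-α)
    rw [norm_smul, norm_smul, Real.norm_of_nonneg hw, norm_pow, Real.norm_of_nonneg hu.1.le]
    exact mul_le_mul_of_nonneg_left
      (mul_le_of_le_one_left (norm_nonneg _) (pow_le_one₀ hu.1.le hu.2)) hw
  · exact Eventually.of_forall fun u _ => hc.mul_left _
  · simp only [tsum_mul_left]
    exact intervalIntegrable_one_sub_rpow_smul hα1 continuousOn_const
  · refine Eventually.of_forall fun u hu => ?_
    rw [uIoc_of_le zero_le_one] at hu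
    exact (hg u (Ioc_subset_Icc_self hu)).const_smul _

end ErdelyiKober

section HolomorphicErdelyiKober

variable {α : ℝ} {f : ℂ → ℂ} {s : Set ℂ} {z : ℂ}

theorem hasDerivAt_comp_smul (hso : IsOpen s) (hs : StarConvex ℝ 0 s)
    (hf : DifferentiableOn ℂ f s) (hz : z ∈ s) {u : ℝ} (hu : u ∈ Icc (0 : ℝ) 1) :
    HasDerivAt (fun u : ℝ => f (u • z)) (z * deriv f (u • z)) u := by
  have hfu := (hf.differentiableAt (hso.mem_nhds (hs.smul_mem hz hu.1 hu.2))).hasDerivAt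
  simpa [Function.comp_def] using hfu.scomp u ((hasDerivAt_id u).smul_const z)

theorem hasDerivAt_erdelyiKober (hα1 : α < 1) (hso : IsOpen s) (hs : StarConvex ℝ 0 s)
    (hf : DifferentiableOn ℂ f s) (hz : z ∈ s) :
    HasDerivAt (erdelyiKober α f) ((Real.Gamma (1 - α))⁻¹ •
      ∫ u in (0 : ℝ)..1, (1 - u) ^ (-α) • u • deriv f (u • z)) z := by
  have hf' := (hf.deriv hso).continuousOn
  obtain ⟨C, hC⟩ := eventually_forall_norm_comp_smul_le hso hs hf' hz
  have hint {w : ℂ} (hw : w ∈ s) := intervalIntegrable_one_sub_rpow_smul hα1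
    (continuousOn_comp_smul hs hf.continuousOn hw)
  refine HasDerivAt.const_smul _ (intervalIntegral.hasDerivAt_integral_of_dominated_loc_of_deriv_le
    (F' := fun w u => (1 - u) ^ (-α) • u • deriv f (u • w))
    (bound := fun u => (1 - u) ^ (-α) • C) (hC.and (hso.mem_nhds hz)) ?_ (hint hz) ?_ ?_ ?_ ?_).2
  · filter_upwards [hso.mem_nhds hz] with w hw
    exact (intervalIntegrable_iff.1 (hint hw)).aestronglyMeasurable
  · exact (intervalIntegrable_iff.1 (intervalIntegrable_one_sub_rpow_smul hα1
      (continuousOn_id.smul (continuousOn_comp_smul hs hf' hz)))).aestronglyMeasurable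
  · refine Eventually.of_forall fun u hu w hw => ?_
    rw [uIoc_of_le zero_le_one] at hu
    have hweight := Real.rpow_nonneg (sub_nonneg.2 hu.2) (-α)
    rw [norm_smul, norm_smul, Real.norm_of_nonneg hweight, Real.norm_of_nonneg hu.1.le]
    exact mul_le_mul_of_nonneg_left ((mul_le_of_le_one_left (norm_nonneg _) hu.2).trans
      (hw.1 u (Ioc_subset_Icc_self hu))) hweight
  · exact intervalIntegrable_one_sub_rpow_smul hα1 continuousOn_const
  · refine Eventually.of_forall fun u hu w hw => ?_
    rw [uIoc_of_le zero_le_one] at hu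
    have hfu := (hf.differentiableAt (hso.mem_nhds (hs.smul_mem hw.2 hu.1.le hu.2))).hasDerivAt
    have hsmul : HasDerivAt (fun w : ℂ => u • w) (u : ℂ) w := by
      simpa using (hasDerivAt_id w).const_mul (u : ℂ)
    simpa [Function.comp_def] using (hfu.scomp w hsmul).fun_const_smul ((1 - u) ^ (-α))

/-- Integration by parts: the weight `(1 - u) ^ (1 - α)` kills the boundary term at `u = 1`, and
`f 0 = 0` the one at `u = 0`. -/
theorem erdelyiKober_add_mul_deriv (hα1 : α < 1) (hso : IsOpen s) (hs : StarConvex ℝ 0 s)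
    (hf : DifferentiableOn ℂ f s) (hf0 : f 0 = 0) (hz : z ∈ s) :
    (1 - α) * erdelyiKober α f z + z * deriv (erdelyiKober α f) z =
      z * erdelyiKober α (deriv f) z := by
  have hf' := continuousOn_comp_smul hs (hf.deriv hso).continuousOn hz
  have huf' : ContinuousOn (fun u : ℝ => u • deriv f (u • z)) (Icc 0 1) := continuousOn_id.smul hf'
  have i₁ := (intervalIntegrable_one_sub_rpow_smul hα1
    (continuousOn_comp_smul hs hf.continuousOn hz)).const_mul (1 - α : ℂ)
  have i₂ := (intervalIntegrable_one_sub_rpow_smul hα1 huf').const_mul z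
  have i₃ := (intervalIntegrable_one_sub_rpow_smul hα1 hf').const_mul z
  have hcont : ContinuousOn (fun u : ℝ => (1 - u) ^ (1 - α) • f (u • z)) (Icc 0 1) :=
    (ContinuousOn.rpow_const (by fun_prop) fun u _ => Or.inr (by linarith)).smul
      (continuousOn_comp_smul hs hf.continuousOn hz)
  have hparts := intervalIntegral.integral_eq_sub_of_hasDerivAt_of_le zero_le_one hcont ?_
    (i₃.sub (i₁.add i₂))
  · rw [intervalIntegral.integral_sub i₃ (i₁.add i₂), intervalIntegral.integral_add i₁ i₂] at hparts
    simp only [intervalIntegral.integral_const_mul, sub_self,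
      Real.zero_rpow (show 1 - α ≠ 0 by linarith), zero_smul, hf0, smul_zero, sub_eq_zero] at hparts
    rw [(hasDerivAt_erdelyiKober hα1 hso hs hf hz).deriv, erdelyiKober, erdelyiKober,
      mul_smul_comm, mul_smul_comm, mul_smul_comm, ← smul_add, hparts]
  · intro u hu
    have hweight : (1 - u) ^ (1 - α) = (1 - u) * (1 - u) ^ (-α) := by
      rw [sub_eq_neg_add 1 α, Real.rpow_add_one (sub_pos.2 hu.2).ne', mul_comm]
    refine ((hasDerivAt_one_sub_rpow hu.2).smul
      (hasDerivAt_comp_smul hso hs hf hz (Ioo_subset_Icc_self hu))).congr_deriv ?_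
    rw [hweight, sub_sub_cancel_left]
    simp only [Complex.real_smul]
    push_cast
    ring

end HolomorphicErdelyiKober

section EulerIntegral

variable {α x : ℝ}

/-- The Euler integral of `Γ(2 - α)⁻¹ ₂F₁(1, 2; 2 - α; x)`, convergent for `x < 1`; it is the
Erdélyi–Kober integral of the derivative of the extremal function `x / (1 - x)`. -/
noncomputable def eulerIntegral (α x : ℝ) : ℝ :=
  erdelyiKober α (fun y : ℝ => ((1 - y) ^ 2)⁻¹) x

theorem starConvex_zero_Iio_one : StarConvex ℝ 0 (Iio (1 : ℝ)) :=
  (convex_Iio 1).starConvex (mem_Iio.2 one_pos)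

theorem continuousOn_inv_one_sub_sq : ContinuousOn (fun y : ℝ => ((1 - y) ^ 2)⁻¹) (Iio 1) :=
  ContinuousOn.inv₀ (by fun_prop) fun _ hy => pow_ne_zero 2 (sub_pos.2 (mem_Iio.1 hy)).ne'

theorem intervalIntegrable_eulerIntegral (hα1 : α < 1) (hx : x < 1) :
    IntervalIntegrable (fun u : ℝ => (1 - u) ^ (-α) • ((1 - u • x) ^ 2)⁻¹) volume 0 1 :=
  intervalIntegrable_one_sub_rpow_smul hα1
    (continuousOn_comp_smul starConvex_zero_Iio_one continuousOn_inv_one_sub_sq hx)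

theorem continuousOn_eulerIntegral (hα1 : α < 1) : ContinuousOn (eulerIntegral α) (Iio 1) :=
  fun _ hx => (continuousAt_erdelyiKober hα1 isOpen_Iio starConvex_zero_Iio_one
    continuousOn_inv_one_sub_sq hx).continuousWithinAt

theorem eulerIntegral_pos (hα1 : α < 1) (hx : x < 1) : 0 < eulerIntegral α x := by
  refine smul_pos (inv_pos.2 (Gamma_one_sub_pos hα1))
    (intervalIntegral.intervalIntegral_pos_of_pos_on (intervalIntegrable_eulerIntegral hα1 hx)
      (fun u hu => ?_) one_pos)
  have hux : u • x < 1 := starConvex_zero_Iio_one.smul_mem hx hu.1.le hu.2.le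
  exact smul_pos (Real.rpow_pos_of_pos (sub_pos.2 hu.2) _) (inv_pos.2 (pow_pos (sub_pos.2 hux) 2))

theorem strictMonoOn_eulerIntegral (hα1 : α < 1) : StrictMonoOn (eulerIntegral α) (Iio 1) := by
  intro x hx y hy hxy
  have ix := intervalIntegrable_eulerIntegral hα1 hx
  have iy := intervalIntegrable_eulerIntegral hα1 hy
  refine smul_lt_smul_of_pos_left ?_ (inv_pos.2 (Gamma_one_sub_pos hα1))
  rw [← sub_pos, ← intervalIntegral.integral_sub iy ix]
  refine intervalIntegral.intervalIntegral_pos_of_pos_on (iy.sub ix) (fun u hu => ?_) one_pos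
  have huy : u • y < 1 := starConvex_zero_Iio_one.smul_mem hy hu.1.le hu.2.le
  have huxy : u • x < u • y := smul_lt_smul_of_pos_left hxy hu.1
  rw [← smul_sub]
  refine smul_pos (Real.rpow_pos_of_pos (sub_pos.2 hu.2) _) (sub_pos.2 ?_)
  have := sub_pos.2 huy
  gcongr

theorem hasSum_eulerIntegral (hα1 : α < 1) (hx : |x| < 1) :
    HasSum (fun n : ℕ => Real.Gamma (n + 2) / Real.Gamma (n + 2 - α) * x ^ n)
      (eulerIntegral α x) := by
  have hgeometric {y : ℝ} (hy : |y| < 1) :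
      HasSum (fun n : ℕ => ((n : ℝ) + 1) * y ^ n) ((1 - y) ^ 2)⁻¹ := by
    simpa using hasSum_choose_mul_geometric_of_norm_lt_one 1 (r := y) (by simpa using hy)
  have hΓ (n : ℕ) : Real.Gamma (n + 2) = (n + 1) * Real.Gamma (n + 1) := by
    rw [← Real.Gamma_add_one (by positivity), add_assoc, one_add_one_eq_two]
  refine (hasSum_erdelyiKober hα1 (hgeometric hx).summable.norm fun u hu => ?_).congr_fun
    fun n => ?_
  · have hux : |u • x| < 1 := by
      rw [smul_eq_mul, abs_mul, abs_of_nonneg hu.1]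
      exact (mul_le_of_le_one_left (abs_nonneg x) hu.2).trans_lt hx
    refine (hgeometric hux).congr_fun fun n => ?_
    simp only [smul_eq_mul, mul_pow]
    ring
  · rw [hΓ, smul_eq_mul]
    ring

theorem Gamma_mul_ascPochhammer_eval {y : ℝ} (hy : 0 < y) (n : ℕ) :
    Real.Gamma y * (ascPochhammer ℝ n).eval y = Real.Gamma (n + y) := by
  induction n with
  | zero => simp
  | succ n ih =>
    rw [ascPochhammer_succ_eval, ← mul_assoc, ih, Nat.cast_succ, add_right_comm,
      Real.Gamma_add_one (by positivity), add_comm y, mul_comm]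

theorem eulerIntegral_eq_ordinaryHypergeometric (hα1 : α < 1) (hx : |x| < 1) :
    eulerIntegral α x = ordinaryHypergeometric (1 : ℝ) 2 (2 - α) x / Real.Gamma (2 - α) := by
  have hα2 : 0 < 2 - α := by linarith
  rw [eq_div_iff (Real.Gamma_pos_of_pos hα2).ne', ordinaryHypergeometric_eq_tsum,
    ← (hasSum_eulerIntegral hα1 hx).tsum_eq, ← tsum_mul_right]
  refine tsum_congr fun n => ?_
  have hfactorial : (n.factorial : ℝ) ≠ 0 := by positivity
  have hnum : (ascPochhammer ℝ n).eval 2 = Real.Gamma (n + 2) := by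
    simpa using Gamma_mul_ascPochhammer_eval two_pos n
  have hden := Gamma_mul_ascPochhammer_eval hα2 n
  rw [← add_sub_assoc] at hden
  have hne : Real.Gamma (n + 2 - α) ≠ 0 := (Real.Gamma_pos_of_pos (by
    have := n.cast_nonneg (α := ℝ)
    linarith)).ne'
  rw [ascPochhammer_eval_one, hnum, smul_eq_mul]
  have hne' : (ascPochhammer ℝ n).eval (2 - α) ≠ 0 := right_ne_zero_of_mul (hden ▸ hne)
  rw [← hden]
  field_simp

theorem tendsto_abs_mul_ordinaryHypergeometric_neg (hα1 : α < 1) :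
    Tendsto (fun t : ℝ => |t ^ (1 - α) / Real.Gamma (2 - α) *
      ordinaryHypergeometric (1 : ℝ) 2 (2 - α) (-t)|) (𝓝[<] 1) (𝓝 (eulerIntegral α (-1))) := by
  have hcont : Tendsto (fun t : ℝ => t ^ (1 - α) * eulerIntegral α (-t)) (𝓝[<] 1)
      (𝓝 (1 ^ (1 - α) * eulerIntegral α (-1))) := by
    refine (ContinuousAt.mul (by fun_prop (disch := simp)) ?_).tendsto.mono_left
      nhdsWithin_le_nhds
    exact ContinuousAt.comp (f := fun t : ℝ => -t) ((continuousOn_eulerIntegral hα1).continuousAt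
      (Iio_mem_nhds (by norm_num))) continuousAt_neg
  rw [Real.one_rpow, one_mul] at hcont
  refine hcont.congr' ?_
  filter_upwards [Ioo_mem_nhdsLT (zero_lt_one' ℝ)] with t ht
  have hpos : 0 < t ^ (1 - α) * eulerIntegral α (-t) :=
    mul_pos (Real.rpow_pos_of_pos ht.1 _) (eulerIntegral_pos hα1 (by linarith [ht.1]))
  rw [← abs_of_pos hpos, eulerIntegral_eq_ordinaryHypergeometric hα1 (by
    rw [abs_neg, abs_of_pos ht.1]; exact ht.2)]
  congr 1
  ring

end EulerIntegral

section FracSeries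

variable {α r P : ℝ}

/-- The sum of the majorant series with all coefficients of modulus `1`, that is, the fractional
derivative of the extremal function `x / (1 - x)` at `r ≥ 0`. -/
noncomputable def fracSeriesSum (α r : ℝ) : ℝ :=
  r ^ (1 - α) * eulerIntegral α r

theorem hasSum_fracTerm (hα1 : α < 1) (hr0 : 0 ≤ r) (hr1 : r < 1) :
    HasSum (fun n : ℕ => fracTerm α r (n + 1)) (fracSeriesSum α r) := by
  refine ((hasSum_eulerIntegral hα1 (by rwa [abs_of_nonneg hr0])).mul_left
    (r ^ (1 - α))).congr_fun fun n => ?_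
  have hexp : 0 < 1 - α + n := by linarith [n.cast_nonneg (α := ℝ)]
  have hpow : r ^ (1 - α + n) = r ^ (1 - α) * r ^ n := by
    rw [Real.rpow_add' hr0 hexp.ne', Real.rpow_natCast]
  rw [fracTerm, Nat.cast_succ, add_assoc, one_add_one_eq_two,
    show (n : ℝ) + 1 - α = 1 - α + n by ring, hpow]
  ring

theorem fracTerm_succ_nonneg (hα1 : α < 1) (hr0 : 0 ≤ r) (n : ℕ) : 0 ≤ fracTerm α r (n + 1) := by
  have hn : 0 < ((n + 1 : ℕ) : ℝ) + 1 - α := by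
    push_cast
    linarith [n.cast_nonneg (α := ℝ)]
  exact mul_nonneg (div_nonneg (Real.Gamma_pos_of_pos (by positivity)).le
    (Real.Gamma_pos_of_pos hn).le) (Real.rpow_nonneg hr0 _)

theorem strictMonoOn_fracSeriesSum (hα1 : α < 1) : StrictMonoOn (fracSeriesSum α) (Ico 0 1) :=
  fun _ hx _ hy hxy => mul_lt_mul'' (Real.rpow_lt_rpow hx.1 hxy (sub_pos.2 hα1))
    (strictMonoOn_eulerIntegral hα1 hx.2 hy.2 hxy) (Real.rpow_nonneg hx.1 _)
    (eulerIntegral_pos hα1 hx.2).le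

theorem continuousOn_fracSeriesSum (hα1 : α < 1) : ContinuousOn (fracSeriesSum α) (Iio 1) :=
  (continuousOn_id.rpow_const fun _ _ => Or.inr (sub_pos.2 hα1).le).mul
    (continuousOn_eulerIntegral hα1)

theorem fracSeriesSum_zero (hα1 : α < 1) : fracSeriesSum α 0 = 0 := by
  rw [fracSeriesSum, Real.zero_rpow (sub_pos.2 hα1).ne', zero_mul]

theorem exists_lt_fracSeriesSum (hα1 : α < 1) {y : ℝ} (hy0 : 0 < y) (hy : y < eulerIntegral α 0) :
    ∃ b ∈ Ioo (0 : ℝ) 1, y < fracSeriesSum α b := by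
  have h1α : 0 < 1 - α := sub_pos.2 hα1
  have h0 : 0 < eulerIntegral α 0 := hy0.trans hy
  have hq : 0 < y / eulerIntegral α 0 := div_pos hy0 h0
  set b := (y / eulerIntegral α 0) ^ (1 - α)⁻¹ with hb
  have hb0 : 0 < b := Real.rpow_pos_of_pos hq _
  have hb1 : b < 1 := Real.rpow_lt_one hq.le ((div_lt_one h0).2 hy) (inv_pos.2 h1α)
  have hbpow : b ^ (1 - α) * eulerIntegral α 0 = y := by
    rw [hb, Real.rpow_inv_rpow hq.le h1α.ne', div_mul_cancel₀ _ h0.ne']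
  refine ⟨b, ⟨hb0, hb1⟩, ?_⟩
  calc y = b ^ (1 - α) * eulerIntegral α 0 := hbpow.symm
    _ < fracSeriesSum α b := mul_lt_mul_of_pos_left
        (strictMonoOn_eulerIntegral hα1 (mem_Iio.2 one_pos) hb1 hb0) (Real.rpow_pos_of_pos hb0 _)

theorem exists_fracSeriesSum_eq (hα1 : α < 1) {y : ℝ} (hy0 : 0 < y) (hy : y < eulerIntegral α 0) :
    ∃ P ∈ Ioo (0 : ℝ) 1, fracSeriesSum α P = y := by
  obtain ⟨b, ⟨hb0, hb1⟩, hb⟩ := exists_lt_fracSeriesSum hα1 hy0 hy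
  obtain ⟨P, hP, rfl⟩ := intermediate_value_Ioo hb0.le
    ((continuousOn_fracSeriesSum hα1).mono fun x hx => hx.2.trans_lt hb1)
    ⟨(fracSeriesSum_zero hα1).trans_lt hy0, hb⟩
  exact ⟨P, ⟨hP.1, hP.2.trans hb1⟩, rfl⟩

theorem isLeast_hasSum_fracTerm (hα1 : α < 1) (hP : P ∈ Ioo (0 : ℝ) 1) :
    IsLeast {r : ℝ | 0 < r ∧ HasSum (fun n : ℕ => fracTerm α r (n + 1)) (fracSeriesSum α P)} P := by
  refine ⟨⟨hP.1, hasSum_fracTerm hα1 hP.1.le hP.2⟩, fun r hr => le_of_not_gt fun hrP => ?_⟩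
  have hr1 : r < 1 := hrP.trans hP.2
  exact (strictMonoOn_fracSeriesSum hα1 ⟨hr.1.le, hr1⟩ ⟨hP.1.le, hP.2⟩ hrP).ne
    ((hasSum_fracTerm hα1 hr.1.le hr1).unique hr.2)

theorem summable_fracTerm_mul {E : Type*} [SeminormedAddCommGroup E] {a : ℕ → E} (hα1 : α < 1)
    (ha : ∀ n ≠ 0, ‖a n‖ ≤ 1) (hr0 : 0 ≤ r) (hr1 : r < 1) :
    Summable fun n : ℕ => fracTerm α r (n + 1) * ‖a (n + 1)‖ :=
  (hasSum_fracTerm hα1 hr0 hr1).summable.of_nonneg_of_le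
    (fun n => mul_nonneg (fracTerm_succ_nonneg hα1 hr0 n) (norm_nonneg _))
    fun n => mul_le_of_le_one_right (fracTerm_succ_nonneg hα1 hr0 n) (ha _ n.succ_ne_zero)

theorem fracMajorant_le (hα1 : α < 1) {a : ℕ → ℂ} (ha : ∀ n ≠ 0, ‖a n‖ ≤ 1) (hr0 : 0 ≤ r)
    (hr1 : r < 1) : fracMajorant α a r ≤ fracSeriesSum α r :=
  hasSum_le (fun n => mul_le_of_le_one_right (fracTerm_succ_nonneg hα1 hr0 n)
    (ha _ n.succ_ne_zero)) (summable_fracTerm_mul hα1 ha hr0 hr1).hasSum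
    (hasSum_fracTerm hα1 hr0 hr1)

end FracSeries

section FracDeriv

variable {α : ℝ} {f : ℂ → ℂ} {ζ : ℂ}

theorem exp_mem_ball (hζ : ζ ∈ logDisc) : Complex.exp ζ ∈ ball (0 : ℂ) 1 := by
  rw [mem_ball_zero_iff, Complex.norm_exp]
  exact Real.exp_lt_one_iff.2 hζ

theorem starConvex_zero_ball : StarConvex ℝ 0 (ball (0 : ℂ) 1) :=
  (convex_ball 0 1).starConvex (mem_ball_self one_pos)

theorem isOpen_logDisc : IsOpen logDisc :=
  isOpen_lt Complex.continuous_re continuous_const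

theorem isPreconnected_logDisc : IsPreconnected logDisc :=
  (convex_halfSpace_re_lt 0).isPreconnected

instance : toCentre.NeBot :=
  NeBot.comap_of_surj atBot_neBot Complex.re_surjective

instance : toCircle.NeBot :=
  NeBot.comap_of_surj (nhdsWithin_Iio_neBot le_rfl) Complex.re_surjective

theorem eventually_mem_logDisc_toCentre : ∀ᶠ ζ in toCentre, ζ ∈ logDisc :=
  tendsto_comap.eventually (eventually_lt_atBot 0)

theorem eventually_mem_logDisc_toCircle : ∀ᶠ ζ in toCircle, ζ ∈ logDisc :=
  tendsto_comap.eventually self_mem_nhdsWithin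

theorem rlPrimitive_eq (hα1 : α < 1) (f : ℂ → ℂ) (ζ : ℂ) :
    rlPrimitive α f ζ = Real.Gamma (1 - α) *
      (Complex.exp ((1 - α) * ζ) * erdelyiKober α f (Complex.exp ζ)) := by
  have hΓ : (Real.Gamma (1 - α) : ℂ) ≠ 0 := Complex.ofReal_ne_zero.2 (Gamma_one_sub_pos hα1).ne'
  have hexp : Complex.exp ((1 - α) * ζ) = Complex.exp (-(α : ℂ) * ζ) * Complex.exp ζ := by
    rw [← Complex.exp_add]
    ring_nf
  rw [erdelyiKober, mul_smul_comm, Complex.real_smul, Complex.ofReal_inv, mul_inv_cancel_left₀ hΓ,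
    ← intervalIntegral.integral_const_mul, rlPrimitive]
  refine intervalIntegral.integral_congr fun u _ => ?_
  simp only [hexp, Complex.real_smul]
  ring

theorem hasDerivAt_rlPrimitive (hα1 : α < 1) (hf : DifferentiableOn ℂ f (ball 0 1))
    (hf0 : f 0 = 0) (hζ : ζ ∈ logDisc) :
    HasDerivAt (rlPrimitive α f) (Real.Gamma (1 - α) * (Complex.exp ((1 - α) * ζ) *
      (Complex.exp ζ * erdelyiKober α (deriv f) (Complex.exp ζ)))) ζ := by
  have hEK := (hasDerivAt_erdelyiKober hα1 isOpen_ball starConvex_zero_ball hf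
    (exp_mem_ball hζ)).differentiableAt.hasDerivAt.comp ζ (Complex.hasDerivAt_exp ζ)
  have hpow : HasDerivAt (fun ζ : ℂ => Complex.exp ((1 - α) * ζ))
      (Complex.exp ((1 - α) * ζ) * (1 - α)) ζ := by
    simpa using ((hasDerivAt_id ζ).const_mul (1 - α : ℂ)).cexp
  rw [funext (rlPrimitive_eq hα1 f)]
  refine ((hpow.mul hEK).const_mul (Real.Gamma (1 - α) : ℂ)).congr_deriv ?_
  rw [← erdelyiKober_add_mul_deriv hα1 isOpen_ball starConvex_zero_ball hf hf0 (exp_mem_ball hζ),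
    Function.comp_apply]
  ring

theorem fracDeriv_eq (hα1 : α < 1) (hf : DifferentiableOn ℂ f (ball 0 1)) (hf0 : f 0 = 0)
    (hζ : ζ ∈ logDisc) :
    fracDeriv α f ζ = Complex.exp ((1 - α) * ζ) * erdelyiKober α (deriv f) (Complex.exp ζ) := by
  have hΓ : (Real.Gamma (1 - α) : ℂ) ≠ 0 := Complex.ofReal_ne_zero.2 (Gamma_one_sub_pos hα1).ne'
  rw [fracDeriv, (hasDerivAt_rlPrimitive hα1 hf hf0 hζ).deriv, inv_mul_eq_iff_eq_mul₀ hΓ,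
    Complex.exp_neg, inv_mul_eq_iff_eq_mul₀ (Complex.exp_ne_zero ζ)]
  ring

theorem norm_fracDeriv (hα1 : α < 1) (hf : DifferentiableOn ℂ f (ball 0 1)) (hf0 : f 0 = 0)
    (hζ : ζ ∈ logDisc) :
    ‖fracDeriv α f ζ‖ =
      Real.exp ((1 - α) * ζ.re) * ‖erdelyiKober α (deriv f) (Complex.exp ζ)‖ := by
  rw [fracDeriv_eq hα1 hf hf0 hζ, norm_mul, Complex.norm_exp, ← Complex.ofReal_one,
    ← Complex.ofReal_sub, Complex.re_ofReal_mul]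

theorem differentiableOn_fracDeriv (hα1 : α < 1) (hf : DifferentiableOn ℂ f (ball 0 1))
    (hf0 : f 0 = 0) : DifferentiableOn ℂ (fracDeriv α f) logDisc := by
  have hEK : DifferentiableOn ℂ (erdelyiKober α (deriv f)) (ball 0 1) := fun z hz =>
    (hasDerivAt_erdelyiKober hα1 isOpen_ball starConvex_zero_ball (hf.deriv isOpen_ball)
      hz).differentiableAt.differentiableWithinAt
  have hpow : DifferentiableOn ℂ (fun ζ : ℂ => Complex.exp ((1 - α) * ζ)) logDisc := by fun_prop
  exact (hpow.mul (hEK.comp Complex.differentiable_exp.differentiableOn fun _ =>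
    exp_mem_ball)).congr fun ζ hζ => fracDeriv_eq hα1 hf hf0 hζ

theorem tendsto_fracDeriv_toCentre (hα1 : α < 1) (hf : DifferentiableOn ℂ f (ball 0 1))
    (hf0 : f 0 = 0) : Tendsto (fracDeriv α f) toCentre (𝓝 0) := by
  have hpow : Tendsto (fun ζ : ℂ => Complex.exp ((1 - α) * ζ)) toCentre (𝓝 0) := by
    refine Complex.tendsto_exp_comap_re_atBot.comp (tendsto_comap_iff.2 ?_)
    have hre (ζ : ℂ) : ((1 - α) * ζ : ℂ).re = (1 - α) * ζ.re := by
      rw [← Complex.ofReal_one, ← Complex.ofReal_sub, Complex.re_ofReal_mul]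
    simp only [Function.comp_def, hre]
    exact tendsto_comap.const_mul_atBot (sub_pos.2 hα1)
  have hEK := (continuousAt_erdelyiKober hα1 isOpen_ball starConvex_zero_ball
    (hf.deriv isOpen_ball).continuousOn (mem_ball_self one_pos)).tendsto.comp
    Complex.tendsto_exp_comap_re_atBot
  have hmul := hpow.mul hEK
  rw [zero_mul] at hmul
  exact hmul.congr' (eventually_mem_logDisc_toCentre.mono fun ζ hζ =>
    (fracDeriv_eq hα1 hf hf0 hζ).symm)

/-- The rotation by `exp (-2πikα)` relating the branches of `D^α f`. -/
noncomputable def branchRotation (α : ℝ) (k : ℤ) : ℂ ≃ᵢ ℂ :=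
  (rotation (Circle.exp (-(2 * Real.pi * k * α)))).toIsometryEquiv

theorem fracDeriv_add_zsmul_two_pi (hα1 : α < 1) (hf : DifferentiableOn ℂ f (ball 0 1))
    (hf0 : f 0 = 0) (hζ : ζ ∈ logDisc) (k : ℤ) :
    fracDeriv α f (ζ + k * (2 * Real.pi * Complex.I)) =
      branchRotation α k (fracDeriv α f ζ) := by
  have hζ' : ζ + k * (2 * Real.pi * Complex.I) ∈ logDisc := by simpa [logDisc] using hζ
  have hpow : Complex.exp ((1 - α) * (ζ + k * (2 * Real.pi * Complex.I))) =
      Circle.exp (-(2 * Real.pi * k * α)) * Complex.exp ((1 - α) * ζ) := by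
    rw [Circle.coe_exp, ← Complex.exp_add, Complex.exp_eq_exp_iff_exists_int]
    refine ⟨k, ?_⟩
    push_cast
    ring
  rw [fracDeriv_eq hα1 hf hf0 hζ, fracDeriv_eq hα1 hf hf0 hζ', hpow, Complex.exp_add,
    Complex.exp_int_mul_two_pi_mul_I, mul_one, mul_assoc]
  rfl

theorem mapsTo_branchRotation (hα1 : α < 1) (hf : DifferentiableOn ℂ f (ball 0 1)) (hf0 : f 0 = 0)
    (k : ℤ) :
    MapsTo (branchRotation α k) (fracDeriv α f '' logDisc) (fracDeriv α f '' logDisc) := by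
  rintro _ ⟨ζ, hζ, rfl⟩
  exact ⟨ζ + k * (2 * Real.pi * Complex.I), by simpa [logDisc] using hζ,
    fracDeriv_add_zsmul_two_pi hα1 hf hf0 hζ k⟩

end FracDeriv

section LowerBound

variable {α : ℝ} {f : ℂ → ℂ} {z : ℂ}

theorem hasDerivAt_neg_one_sub_div_one_add {u : ℝ} (hu : 0 ≤ u) :
    HasDerivAt (fun u : ℝ => -((1 - u) / (1 + u)) / 2) ((1 + u) ^ 2)⁻¹ u := by
  have hne : 1 + u ≠ 0 := by positivity
  refine (((((hasDerivAt_id u).const_sub 1).div ((hasDerivAt_id u).const_add 1)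
    hne).neg).div_const 2).congr_deriv ?_
  simp only [id_eq]
  field_simp
  ring

theorem IsConvexUnivalent.exists_mul_integral_le_integral_re (hα0 : 0 ≤ α) (hα1 : α < 1)
    (hf : IsConvexUnivalent f) (hz0 : z ≠ 0) (hz : z ∈ ball (0 : ℂ) 1) :
    ∃ ν ≠ 0, ‖deriv f 0 * z * ν‖ * ∫ u in (0 : ℝ)..1, (1 - u) ^ (-α) * ((1 + u) ^ 2)⁻¹ ≤
      ∫ u in (0 : ℝ)..1, (1 - u) ^ (-α) * (z * deriv f (u • z) * ν).re := by
  obtain ⟨ν, hν0, hν⟩ := hf.exists_support_radial hz0 (mem_ball_zero_iff.1 hz)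
  refine ⟨ν, hν0, ?_⟩
  rw [← intervalIntegral.integral_const_mul]
  simp only [mul_left_comm ‖deriv f 0 * z * ν‖]
  refine integral_one_sub_rpow_mul_deriv_mono hα0 hα1
    (φ := fun u => ‖deriv f 0 * z * ν‖ * (-((1 - u) / (1 + u)) / 2))
    (ψ := fun u => ((f (u • z) - f z) * ν).re) (fun u hu =>
      (hasDerivAt_neg_one_sub_div_one_add hu.1).const_mul _) ?_ (fun u hu => ?_) ?_ (by simp)
    fun u hu => ?_
  · exact continuousOn_const.mul (ContinuousOn.inv₀ (by fun_prop) fun u hu =>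
      pow_ne_zero 2 (add_pos_of_pos_of_nonneg one_pos hu.1).ne')
  · exact Complex.reCLM.hasFDerivAt.comp_hasDerivAt u
      (((hasDerivAt_comp_smul isOpen_ball starConvex_zero_ball hf.differentiableOn hz
        hu).sub_const _).mul_const ν)
  · have hf' := continuousOn_comp_smul starConvex_zero_ball
      (hf.differentiableOn.deriv isOpen_ball).continuousOn hz
    exact Complex.continuous_re.comp_continuousOn ((continuousOn_const.mul hf').mul
      continuousOn_const)
  · have hsupport := hν u hu
    rw [← neg_sub (f (u • z)), neg_mul, Complex.neg_re] at hsupport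
    linarith

theorem IsConvexUnivalent.le_norm_erdelyiKober_deriv (hα0 : 0 ≤ α) (hα1 : α < 1)
    (hf : IsConvexUnivalent f) (hz0 : z ≠ 0) (hz : z ∈ ball (0 : ℂ) 1) :
    ‖deriv f 0‖ * eulerIntegral α (-1) ≤ ‖erdelyiKober α (deriv f) z‖ := by
  obtain ⟨ν, hν0, hν⟩ := hf.exists_mul_integral_le_integral_re hα0 hα1 hz0 hz
  have hint := (intervalIntegrable_one_sub_rpow_smul hα1 (continuousOn_comp_smul
    starConvex_zero_ball (hf.differentiableOn.deriv isOpen_ball).continuousOn hz)).mul_const (z * ν)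
  set I := ∫ u in (0 : ℝ)..1, (1 - u) ^ (-α) • deriv f (u • z) with hI
  have hre : ∫ u in (0 : ℝ)..1, (1 - u) ^ (-α) * (z * deriv f (u • z) * ν).re =
      (I * (z * ν)).re := by
    rw [hI, ← intervalIntegral.integral_mul_const]
    refine Eq.trans (intervalIntegral.integral_congr fun u _ => ?_)
      (Complex.reCLM.intervalIntegral_comp_comm hint)
    rw [Complex.reCLM_apply, smul_mul_assoc, Complex.smul_re, smul_eq_mul]
    ring_nf
  have hle : ‖deriv f 0‖ * (∫ u in (0 : ℝ)..1, (1 - u) ^ (-α) * ((1 + u) ^ 2)⁻¹) ≤ ‖I‖ := by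
    have hpos : 0 < ‖z * ν‖ := norm_pos_iff.2 (mul_ne_zero hz0 hν0)
    refine le_of_mul_le_mul_right ?_ hpos
    rw [← norm_mul I]
    refine le_trans (le_of_eq ?_) ((hν.trans_eq hre).trans (Complex.re_le_norm _))
    rw [mul_assoc (deriv f 0), norm_mul _ (z * ν)]
    ring
  rw [erdelyiKober, eulerIntegral, erdelyiKober, norm_smul, smul_eq_mul, mul_left_comm,
    Real.norm_of_nonneg (inv_nonneg.2 (Gamma_one_sub_pos hα1).le)]
  simp only [smul_eq_mul, mul_neg, mul_one, sub_neg_eq_add]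
  exact mul_le_mul_of_nonneg_left hle (inv_nonneg.2 (Gamma_one_sub_pos hα1).le)

end LowerBound

section Covering

theorem closure_iUnion_image_subset {ι X : Type*} [PseudoMetricSpace X] {g : ι → X ≃ᵢ X}
    {K U : Set X} (hK : IsCompact K) (hU : IsOpen U) (hKU : K ⊆ U)
    (hg : ∀ i, MapsTo (g i) U U) : closure (⋃ i, g i '' K) ⊆ U := by
  obtain ⟨δ, hδ, hthick⟩ := hK.exists_thickening_subset_open hU hKU
  intro x hx
  obtain ⟨_, hy, hxy⟩ := Metric.mem_closure_iff.1 hx δ hδ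
  obtain ⟨i, y, hyK, rfl⟩ := mem_iUnion.1 hy
  have hmem : (g i).symm x ∈ thickening δ K := by
    refine mem_thickening_iff.2 ⟨y, hyK, ?_⟩
    rwa [← (g i).dist_eq, (g i).apply_symm_apply]
  simpa using hg i (hthick hmem)

theorem isPreconnected_ball_diff_zero {R : ℝ} (hR : 0 < R) :
    IsPreconnected (ball (0 : ℂ) R \ {0}) := by
  have himage : Complex.exp '' {s : ℂ | s.re < Real.log R} = ball 0 R \ {0} := by
    ext w
    rw [Set.mem_sdiff, mem_ball_zero_iff, mem_singleton_iff]
    constructor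
    · rintro ⟨s, hs, rfl⟩
      refine ⟨?_, Complex.exp_ne_zero s⟩
      rw [Complex.norm_exp]
      exact (Real.lt_log_iff_exp_lt hR).1 hs
    · rintro ⟨hwR, hw⟩
      refine ⟨Complex.log w, ?_, Complex.exp_log hw⟩
      rw [mem_ofPred_eq, Complex.log_re]
      exact Real.log_lt_log (norm_pos_iff.2 hw) hwR
  rw [← himage]
  exact (convex_halfSpace_re_lt _).isPreconnected.image _ Complex.continuous_exp.continuousOn

theorem ofReal_le_infEDist_frontier {X : Type*} [PseudoMetricSpace X] {s : Set X} {x : X} {R : ℝ}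
    (h : ball x R ⊆ s) : ENNReal.ofReal R ≤ infEDist x (frontier s) := by
  refine le_infEDist.2 fun y hy => ?_
  have hyball : y ∉ ball x R := fun hmem => hy.2 (interior_maximal h isOpen_ball hmem)
  rw [edist_dist, dist_comm]
  exact ENNReal.ofReal_le_ofReal (not_lt.1 hyball)

theorem tendsto_exp_mul_re_mul_toCircle (α L : ℝ) :
    Tendsto (fun ζ : ℂ => Real.exp ((1 - α) * ζ.re) * L) toCircle (𝓝 L) := by
  have hcont : ContinuousAt (fun x : ℝ => Real.exp ((1 - α) * x) * L) 0 := by fun_prop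
  have hlim : Tendsto (fun ζ : ℂ => Real.exp ((1 - α) * ζ.re) * L) toCircle
      (𝓝 (Real.exp ((1 - α) * 0) * L)) :=
    (hcont.tendsto.mono_left nhdsWithin_le_nhds).comp tendsto_comap
  rwa [mul_zero, Real.exp_zero, one_mul] at hlim

namespace IsNormalizedConvexUnivalent

variable {α : ℝ} {f : ℂ → ℂ} {ζ : ℂ}

theorem le_norm_fracDeriv (hα0 : 0 ≤ α) (hα1 : α < 1) (hf : IsNormalizedConvexUnivalent f)
    (hζ : ζ ∈ logDisc) :
    Real.exp ((1 - α) * ζ.re) * eulerIntegral α (-1) ≤ ‖fracDeriv α f ζ‖ := by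
  have hEK := hf.isConvexUnivalent.le_norm_erdelyiKober_deriv hα0 hα1 (Complex.exp_ne_zero ζ)
    (exp_mem_ball hζ)
  rw [hf.deriv_zero, norm_one, one_mul] at hEK
  rw [norm_fracDeriv hα1 hf.holomorphic hf.map_zero hζ]
  exact mul_le_mul_of_nonneg_left hEK (Real.exp_pos _).le

theorem fracDeriv_ne_zero (hα0 : 0 ≤ α) (hα1 : α < 1) (hf : IsNormalizedConvexUnivalent f)
    (hζ : ζ ∈ logDisc) : fracDeriv α f ζ ≠ 0 :=
  norm_pos_iff.1 ((mul_pos (Real.exp_pos _) (eulerIntegral_pos hα1 (by norm_num))).trans_le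
    (hf.le_norm_fracDeriv hα0 hα1 hζ))

theorem isOpen_image_fracDeriv (hα0 : 0 ≤ α) (hα1 : α < 1) (hf : IsNormalizedConvexUnivalent f) :
    IsOpen (fracDeriv α f '' logDisc) := by
  have hanalytic := (differentiableOn_fracDeriv hα1 hf.holomorphic hf.map_zero).analyticOnNhd
    isOpen_logDisc
  refine (hanalytic.is_constant_or_isOpen isPreconnected_logDisc).elim ?_
    fun hopen => hopen _ subset_rfl isOpen_logDisc
  rintro ⟨w, hw⟩
  have hlim : Tendsto (fracDeriv α f) toCentre (𝓝 w) :=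
    tendsto_const_nhds.congr' (eventually_mem_logDisc_toCentre.mono fun ζ hζ => (hw ζ hζ).symm)
  obtain ⟨ζ, hζ⟩ := eventually_mem_logDisc_toCentre.exists
  refine absurd ?_ (hf.fracDeriv_ne_zero hα0 hα1 hζ)
  rw [hw ζ hζ]
  exact tendsto_nhds_unique hlim (tendsto_fracDeriv_toCentre hα1 hf.holomorphic hf.map_zero)

theorem exists_forall_re_le (hα0 : 0 ≤ α) (hα1 : α < 1) (hf : IsNormalizedConvexUnivalent f)
    {η : ℝ} (hη : η < eulerIntegral α (-1)) :
    ∃ c < 0, ∀ ζ ∈ logDisc, ‖fracDeriv α f ζ‖ < η → ζ.re ≤ c := by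
  have hlarge := (tendsto_exp_mul_re_mul_toCircle α (eulerIntegral α (-1))).eventually_const_lt hη
  rw [toCircle, eventually_comap] at hlarge
  obtain ⟨c, hc, hIoo⟩ := mem_nhdsLT_iff_exists_Ioo_subset.1 hlarge
  refine ⟨c, hc, fun ζ hζ hζη => le_of_not_gt fun hcζ => hζη.not_ge ?_⟩
  exact (hIoo ⟨hcζ, hζ⟩ ζ rfl).le.trans (hf.le_norm_fracDeriv hα0 hα1 hζ)

end IsNormalizedConvexUnivalent

theorem exists_forall_le_re {α ε : ℝ} {f : ℂ → ℂ} (hα1 : α < 1)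
    (hf : DifferentiableOn ℂ f (ball 0 1)) (hf0 : f 0 = 0) (hε : 0 < ε) :
    ∃ b, ∀ ζ, ε < ‖fracDeriv α f ζ‖ → b ≤ ζ.re := by
  have hsmall := (tendsto_fracDeriv_toCentre hα1 hf hf0).eventually (ball_mem_nhds 0 hε)
  rw [toCentre, eventually_comap] at hsmall
  obtain ⟨b, hb⟩ := eventually_atBot.1 hsmall
  refine ⟨b, fun ζ hζ => le_of_not_gt fun hζb => hζ.not_ge ?_⟩
  exact (mem_ball_zero_iff.1 (hb ζ.re hζb.le ζ rfl)).le

theorem image_fracDeriv_strip_subset {α b c : ℝ} {f : ℂ → ℂ} (hα1 : α < 1)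
    (hf : DifferentiableOn ℂ f (ball 0 1)) (hf0 : f 0 = 0) (hc : c < 0) :
    fracDeriv α f '' (Complex.re ⁻¹' Icc b c) ⊆
      ⋃ k, branchRotation α k '' (fracDeriv α f '' (Icc b c ×ℂ Icc 0 (2 * Real.pi))) := by
  rintro _ ⟨ζ, hζ, rfl⟩
  obtain ⟨k, hk, -⟩ := existsUnique_add_zsmul_mem_Ico Real.two_pi_pos ζ.im 0
  rw [zero_add, zsmul_eq_mul] at hk
  set ζ' := ζ + k * (2 * Real.pi * Complex.I) with hζ'
  have hre : ζ'.re = ζ.re := by simp [hζ']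
  have him : ζ'.im = ζ.im + k * (2 * Real.pi) := by simp [hζ']
  have hback : ζ = ζ' + (-k : ℤ) * (2 * Real.pi * Complex.I) := by
    rw [hζ']
    push_cast
    ring
  have hζ'disc : ζ' ∈ logDisc := hre.trans_lt (hζ.2.trans_lt hc)
  refine mem_iUnion.2 ⟨-k, _, ⟨ζ', ⟨?_, ?_⟩, rfl⟩, ?_⟩
  · rwa [mem_preimage, hre]
  · rw [mem_preimage, him]
    exact Ico_subset_Icc_self hk
  · rw [← fracDeriv_add_zsmul_two_pi hα1 hf hf0 hζ'disc, ← hback]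

namespace IsNormalizedConvexUnivalent

variable {α : ℝ} {f : ℂ → ℂ}

theorem closure_image_fracDeriv_inter_subset (hα0 : 0 ≤ α) (hα1 : α < 1)
    (hf : IsNormalizedConvexUnivalent f) :
    closure (fracDeriv α f '' logDisc) ∩ (ball 0 (eulerIntegral α (-1)) \ {0}) ⊆
      fracDeriv α f '' logDisc := by
  rintro w ⟨hw, hwL, hw0⟩
  obtain ⟨ε, hε, hεw⟩ := exists_between (norm_pos_iff.2 hw0)
  obtain ⟨η, hwη, hη⟩ := exists_between (mem_ball_zero_iff.1 hwL)
  obtain ⟨c, hc, hre_le⟩ := hf.exists_forall_re_le hα0 hα1 hη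
  obtain ⟨b, hle_re⟩ := exists_forall_le_re hα1 hf.holomorphic hf.map_zero hε
  set A : Set ℂ := norm ⁻¹' Ioo ε η
  set Q : Set ℂ := Icc b c ×ℂ Icc 0 (2 * Real.pi)
  have hstrip : A ∩ fracDeriv α f '' logDisc ⊆ fracDeriv α f '' (Complex.re ⁻¹' Icc b c) := by
    rintro _ ⟨hζA, ζ, hζ, rfl⟩
    exact ⟨ζ, ⟨hle_re ζ hζA.1, hre_le ζ hζ hζA.2⟩, rfl⟩
  have hQdisc : Q ⊆ logDisc := fun ζ hζ => hζ.1.2.trans_lt hc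
  have hcompact : IsCompact (fracDeriv α f '' Q) :=
    (isCompact_Icc.reProdIm isCompact_Icc).image_of_continuousOn
      ((differentiableOn_fracDeriv hα1 hf.holomorphic hf.map_zero).continuousOn.mono hQdisc)
  have hwA : w ∈ closure (A ∩ fracDeriv α f '' logDisc) :=
    (isOpen_Ioo.preimage continuous_norm).inter_closure ⟨⟨hεw, hwη⟩, hw⟩
  exact closure_iUnion_image_subset hcompact (hf.isOpen_image_fracDeriv hα0 hα1)
    (image_mono hQdisc) (mapsTo_branchRotation hα1 hf.holomorphic hf.map_zero)
    (closure_mono (hstrip.trans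
      (image_fracDeriv_strip_subset hα1 hf.holomorphic hf.map_zero hc)) hwA)

theorem ball_subset_fracImage (hα0 : 0 ≤ α) (hα1 : α < 1) (hf : IsNormalizedConvexUnivalent f) :
    ball 0 (eulerIntegral α (-1)) ⊆ fracImage α f 0 := by
  have hL : 0 < eulerIntegral α (-1) := eulerIntegral_pos hα1 (by norm_num)
  have hmeet : (ball 0 (eulerIntegral α (-1)) \ {0} ∩ fracDeriv α f '' logDisc).Nonempty := by
    obtain ⟨ζ, hsmall, hζ⟩ := (((tendsto_fracDeriv_toCentre hα1 hf.holomorphic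
      hf.map_zero).eventually (ball_mem_nhds 0 hL)).and eventually_mem_logDisc_toCentre).exists
    exact ⟨_, ⟨hsmall, hf.fracDeriv_ne_zero hα0 hα1 hζ⟩, mem_image_of_mem _ hζ⟩
  have hpunctured := (isPreconnected_ball_diff_zero hL).subset_of_closure_inter_subset
    (hf.isOpen_image_fracDeriv hα0 hα1) hmeet (hf.closure_image_fracDeriv_inter_subset hα0 hα1)
  exact fun w hw => or_iff_not_imp_left.2 fun hw0 => hpunctured ⟨hw, hw0⟩

theorem le_liminf_fracDeriv (hα0 : 0 ≤ α) (hα1 : α < 1) (hf : IsNormalizedConvexUnivalent f) :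
    ENNReal.ofReal (eulerIntegral α (-1)) ≤
      liminf (fun ζ : ℂ => edist (fracDeriv α f ζ) 0) toCircle := by
  rw [← (ENNReal.tendsto_ofReal (tendsto_exp_mul_re_mul_toCircle α _)).liminf_eq]
  refine liminf_le_liminf (eventually_mem_logDisc_toCircle.mono fun ζ hζ => ?_)
  rw [edist_dist, dist_zero_right]
  exact ENNReal.ofReal_le_ofReal (hf.le_norm_fracDeriv hα0 hα1 hζ)

end IsNormalizedConvexUnivalent

end Covering

theorem theorem3p8 (α : ℝ) (hα0 : 0 < α) (hα1 : α < 1) :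
    ∃ L P : ℝ,
      Tendsto (fun t : ℝ => |t ^ (1 - α) / Real.Gamma (2 - α) *
        ordinaryHypergeometric (1 : ℝ) 2 (2 - α) (-t)|) (𝓝[<] 1) (𝓝 L) ∧
      IsLeast {r : ℝ | 0 < r ∧ HasSum (fun n : ℕ => fracTerm α r (n + 1)) L} P ∧
      P < 1 ∧
      ∀ (f : ℂ → ℂ) (a : ℕ → ℂ), IsNormalizedConvexUnivalent f →
        (∀ z ∈ Metric.ball (0 : ℂ) 1, HasSum (fun n : ℕ => a n * z ^ n) (f z)) →
        ∃ w₀ : ℂ, Tendsto (fracDeriv α f) toCentre (𝓝 w₀) ∧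
          ∀ r : ℝ, 0 ≤ r → r ≤ P →
            Summable (fun n : ℕ => fracTerm α r (n + 1) * ‖a (n + 1)‖) ∧
            ENNReal.ofReal (fracMajorant α a r) ≤
              Metric.infEDist w₀ (frontier (fracImage α f w₀)) ∧
            ENNReal.ofReal (fracMajorant α a r) ≤
              liminf (fun ζ : ℂ => edist (fracDeriv α f ζ) w₀) toCircle := by
  have hL_pos : 0 < eulerIntegral α (-1) := eulerIntegral_pos hα1 (by norm_num)
  have hL_lt : eulerIntegral α (-1) < eulerIntegral α 0 :=
    strictMonoOn_eulerIntegral hα1 (by simp) (by simp) (by norm_num)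
  obtain ⟨P, hP, hPL⟩ := exists_fracSeriesSum_eq hα1 hL_pos hL_lt
  refine ⟨eulerIntegral α (-1), P, tendsto_abs_mul_ordinaryHypergeometric_neg hα1,
    hPL ▸ isLeast_hasSum_fracTerm hα1 hP, hP.2, fun f a hf ha =>
      ⟨0, tendsto_fracDeriv_toCentre hα1 hf.holomorphic hf.map_zero, fun r hr0 hrP => ?_⟩⟩
  have hr1 : r < 1 := hrP.trans_lt hP.2
  have hcoeff : ∀ n ≠ 0, ‖a n‖ ≤ 1 := fun n hn =>
    (hf.isConvexUnivalent.norm_coeff_le ha hn).trans_eq (by rw [hf.deriv_zero, norm_one])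
  have hmajorant : ENNReal.ofReal (fracMajorant α a r) ≤ ENNReal.ofReal (eulerIntegral α (-1)) :=
    ENNReal.ofReal_le_ofReal <| calc
      fracMajorant α a r ≤ fracSeriesSum α r := fracMajorant_le hα1 hcoeff hr0 hr1
      _ ≤ fracSeriesSum α P :=
        (strictMonoOn_fracSeriesSum hα1).monotoneOn ⟨hr0, hr1⟩ ⟨hP.1.le, hP.2⟩ hrP
      _ = eulerIntegral α (-1) := hPL
  exact ⟨summable_fracTerm_mul hα1 hcoeff hr0 hr1,
    hmajorant.trans (ofReal_le_infEDist_frontier (hf.ball_subset_fracImage hα0.le hα1)),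
    hmajorant.trans (hf.le_liminf_fracDeriv hα0.le hα1)⟩
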